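/- Let $\rho_1$ be a probability density on $\mathbb R$, let $\rho_d(x)=\rho_1(x_1)\cdots\rho_1(x_d)$ and $\mathcal L_2=L_2(\mathbb R^d,\rho_d)$. For every $\gamma>0$ let $K_\gamma:\mathbb R\times\mathbb R\to\mathbb R$ be a measurable symmetric positive definite (reproducing) kernel with $\int_{\mathbb R}K_\gamma(t,t)\rho_1(t)\,dt=1$, and let $\tilde\lambda_{\gamma,1}\ge\tilde\lambda_{\gamma,2}\ge\cdots$ be the eigenvalues, with multiplicity, of $f\mapsto\int_{\mathbb R}f(t)K_\gamma(\cdot,t)\rho_1(t)\,dt$ on the reproducing kernel Hilbert space of $K_\gamma$. Let $\alpha_\ell\in[0,1]$ and $\gamma_\ell>0$ for $\ell\in\mathbb N=\{1,2,\dots\}$, and let $\mathcal H_d$ be the Hilbert space of functions on $\mathbb R^d$ with reproducing kernel $$\prod_{\ell=1}^d\bigl(1-\alpha_\ell^2+\alpha_\ell^2K_{\gamma_\ell}(x_\ell,t_\ell)\bigr).$$ Let $\|I_d\|$ be the norm of the embedding $\mathcal H_d\to\mathcal L_2$. Let $$e(n,\mathcal H_d)=\inf\ \sup_{\|f\|_{\mathcal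 H_d}\le1}\Bigl\|f-\sum_{j=1}^nL_j(f)a_j\Bigr\|_{\mathcal L_2},$$ the infimum being over all continuous linear functionals $L_j$ on $\mathcal H_d$ and all $a_j\in\mathcal L_2$. For $\varepsilon\in(0,1)$ let $n^{\rm nor}(\varepsilon,\mathcal H_d)$ be the least $n$ with $e(n,\mathcal H_d)\le\varepsilon\|I_d\|$, and $n^{\rm abs}(\varepsilon,\mathcal H_d)$ the least $n$ with $e(n,\mathcal H_d)\le\varepsilon$. Put $$\tilde r=\sup\Bigl\{\beta>0:\ \sum_{\ell=1}^\infty(\alpha_\ell\gamma_\ell)^{1/\beta}<\infty\Bigr\}\in[0,\infty],$$ and assume $\tilde r\ge1/2$. Assume that there are constants $C_1,C_2,C_3>0$, independent of $\gamma$, such that $$\int_{\mathbb R^2}K_\gamma(x,t)\rho_1(x)\rho_1(t)\,dx\,dt\ge1-C_1\gamma^2,\qquad C_2\le\sum_{j\ge2,\ \tilde\lambda_{\gamma,j}>0}\Bigl(\frac{\tilde\lambda_{\gamma,j}}{\gamma^2}\Bigr)^{1/(2\tilde r)}\le C_3$$ for all $\gamma>0$ with $\gamma\le\gamma_\ell$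 for some $\ell$ (that is, for all $0<\gamma<\sup_\ell\gamma_\ell$, and for $\gamma=\sup_\ell\gamma_\ell$ if the supremum is attained). Here $1/(2\tilde r)=0$ if $\tilde r=\infty$. Then approximation with arbitrary linear functionals under the normalized error criterion is strongly polynomially tractable, with exponent $p^{\rm all}=1/\tilde r$ (which is $0$ if $\tilde r=\infty$). That is, $p^{\rm all}$ is the infimum of all $p$ for which there is a $C$ with $n^{\rm nor}(\varepsilon,\mathcal H_d)\le C\varepsilon^{-p}$ for all $d\in\mathbb N$ and $\varepsilon\in(0,1)$, and such $p$ exist. Moreover, as $n\to\infty$ and $\varepsilon\to0$, $$e(n,\mathcal H_d)\preceq\|I_d\|\,n^{-\tilde r},\qquad e(n,\mathcal H_d)\preceq n^{-\tilde r},\qquad n^{\rm nor}(\varepsilon,\mathcal H_d)\preceq\varepsilon^{-p^{\rm all}},\qquad n^{\rm abs}(\varepsilon,\mathcal H_d)\preceq\varepsilon^{-p^{\rm all}}.$$ Here $\preceq s_d\,n^{q}$ (with $s_d=\|I_d\|$ or $s_d=1$) means that for every real $t>q$ there is a $C>0$, independent of $d$ and $n$, such that the quantity is at most $C s_d\,n^{t}$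 for all $d,n\in\mathbb N$. Likewise $\preceq\varepsilon^{-p}$ means that for every $\delta>0$ there is a $C>0$, independent of $d$ and $\varepsilon$, such that the quantity is at most $C\varepsilon^{-(p+\delta)}$ for all $d\in\mathbb N$ and $\varepsilon\in(0,1)$. -/

import Mathlib

open MeasureTheory
open scoped ENNReal

noncomputable section

namespace KernelApprox

/-! ### The weight -/

/-- The probability measure on the real line with (Lebesgue) density `ρ`. -/
def marginal (ρ : ℝ → ℝ) : Measure ℝ :=
  volume.withDensity (fun x => ENNReal.ofReal (ρ x))

/-- The measure on `ℝ^d` with density `x ↦ ρ (x 1) ⋯ ρ (x d)`, i.e. with independent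
marginals of density `ρ`. -/
def weight (ρ : ℝ → ℝ) (d : ℕ) : Measure (Fin d → ℝ) :=
  Measure.pi (fun _ => marginal ρ)

/-! ### Kernels -/

/-- The one-dimensional kernel `1 - a² + a² K_g (x, t)`. -/
def hatKernel (K : ℝ → ℝ → ℝ → ℝ) (a g x t : ℝ) : ℝ :=
  1 - a ^ 2 + a ^ 2 * K g x t

/-- The product kernel on `ℝ^d` with scale parameters `α` and shape parameters `γ`. -/
def productKernel (K : ℝ → ℝ → ℝ → ℝ) (α γ : ℕ → ℝ) (d : ℕ) (x t : Fin d → ℝ) : ℝ :=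
  ∏ l : Fin d, hatKernel K (α l) (γ l) (x l) (t l)

section Space

variable {X : Type*} (H : Type*) [NormedAddCommGroup H] [InnerProductSpace ℝ H]
  [RKHS ℝ H X ℝ]

/-- The real-valued reproducing kernel of a Hilbert space of real functions on `X`. -/
def reproducingKernel [CompleteSpace H] (x t : X) : ℝ := RKHS.kernel H x t (1 : ℝ)

/-- `f` is an eigenfunction, with eigenvalue `c`, of the operator
`(W f)(x) = ∫ f(t) K(x,t) dμ(t)`, where `K` is the reproducing kernel of `H`. The zero function is
not excluded. -/
def IsEigenpair [CompleteSpace H] [MeasurableSpace X] (μ : Measure X) (c : ℝ) (f : H) : Prop :=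
  ∀ x : X, ∫ t, f t * reproducingKernel H x t ∂μ = c * f x

/-- The eigenvalues of `W`, counted with multiplicity, in weakly decreasing order and starting with
the index `0`: the `j`-th one is the largest `c` such that there are `j + 1` orthonormal
eigenfunctions with eigenvalues at least `c`. It is `0` if there are not so many. -/
def eigenvalue [CompleteSpace H] [MeasurableSpace X] (μ : Measure X) (j : ℕ) : ℝ :=
  sSup {c : ℝ | ∃ η : Fin (j + 1) → H, Orthonormal ℝ η ∧
    ∀ i, ∃ b : ℝ, c ≤ b ∧ IsEigenpair H μ b (η i)}

/-! ### Algorithms and errors -/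

variable {H} in
/-- The linear algorithm `f ↦ ∑ j, L_j(f) a_j`. -/
def linearAlgorithm {n : ℕ} (L : Fin n → H →L[ℝ] ℝ) (a : Fin n → X → ℝ) (f : H) (x : X) : ℝ :=
  ∑ j, L j f * a j x

variable {H} in
/-- The worst case error of `A` over the unit ball of `H`, measured in `L²(μ)`. -/
def worstCaseError [MeasurableSpace X] (μ : Measure X) (A : H → X → ℝ) : ℝ≥0∞ :=
  ⨆ (f : H) (_ : ‖f‖ ≤ 1), eLpNorm (fun x => f x - A f x) 2 μ

/-- The `n`-th minimal worst case error over all linear algorithms that use `n` arbitrary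
continuous linear functionals. -/
def minimalError [MeasurableSpace X] (μ : Measure X) (n : ℕ) : ℝ≥0∞ :=
  ⨅ (L : Fin n → H →L[ℝ] ℝ) (a : Fin n → X → ℝ) (_ : ∀ j, MemLp (a j) 2 μ),
    worstCaseError μ (linearAlgorithm L a)

/-- The norm of the embedding of `H` into `L²(μ)`. -/
def embeddingNorm [MeasurableSpace X] (μ : Measure X) : ℝ≥0∞ :=
  ⨆ (f : H) (_ : ‖f‖ ≤ 1), eLpNorm (fun x => f x) 2 μ

/-- The information complexity for the absolute error criterion: the least `n` with
`e(n) ≤ ε` (`⊤` if there is none). -/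
def complexityAbs [MeasurableSpace X] (μ : Measure X) (ε : ℝ) : ℕ∞ :=
  ⨅ (n : ℕ) (_ : minimalError H μ n ≤ ENNReal.ofReal ε), (n : ℕ∞)

/-- The information complexity for the normalized error criterion: the least `n` with
`e(n) ≤ ε ‖I‖` (`⊤` if there is none). -/
def complexityNorm [MeasurableSpace X] (μ : Measure X) (ε : ℝ) : ℕ∞ :=
  ⨅ (n : ℕ) (_ : minimalError H μ n ≤ ENNReal.ofReal ε * embeddingNorm H μ), (n : ℕ∞)

end Space

/-! ### Tractability and rates, uniform in the dimension `d ≥ 1` -/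

/-- `N d ε ≤ C ε^(-p)` for all `d ≥ 1` and `ε ∈ (0,1)`, with `C` independent of `d` and `ε`. -/
def StrongBound (N : ℕ → ℝ → ℕ∞) (p : ℝ) : Prop :=
  ∃ C : ℝ, ∀ d : ℕ, 1 ≤ d → ∀ ε : ℝ, 0 < ε → ε < 1 →
    ((N d ε : ℕ∞) : ℝ≥0∞) ≤ ENNReal.ofReal (C * ε ^ (-p))

/-- Strong polynomial tractability. -/
def StronglyPolynomiallyTractable (N : ℕ → ℝ → ℕ∞) : Prop :=
  ∃ p : ℝ, StrongBound N p

/-- `p` is the exponent of strong polynomial tractability: the infimum of the admissible powers. -/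
def IsTractabilityExponent (N : ℕ → ℝ → ℕ∞) (p : ℝ) : Prop :=
  IsGLB {p' : ℝ | StrongBound N p'} p

/-- `F d n ⪯ s d * n^q` as `n → ∞`: for every real `t > q` (that is, `t = q + δ` with `δ > 0` if
`q` is finite) there is `C > 0`, independent of `d` and `n`, with `F d n ≤ C * s d * n^t` for all
`d, n ≥ 1`. -/
def PreceqPow (F : ℕ → ℕ → ℝ≥0∞) (s : ℕ → ℝ≥0∞) (q : EReal) : Prop :=
  ∀ t : ℝ, q < (t : EReal) → ∃ C : ℝ, 0 < C ∧ ∀ d : ℕ, 1 ≤ d → ∀ n : ℕ, 1 ≤ n →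
    F d n ≤ ENNReal.ofReal C * s d * ENNReal.ofReal ((n : ℝ) ^ t)

/-- `N d ε ⪯ ε^(-p)` as `ε → 0`: for every `δ > 0` there is `C > 0`, independent of `d` and `ε`,
with `N d ε ≤ C ε^(-(p + δ))` for all `d ≥ 1` and `ε ∈ (0,1)`. -/
def PreceqEps (N : ℕ → ℝ → ℕ∞) (p : ℝ) : Prop :=
  ∀ δ : ℝ, 0 < δ → ∃ C : ℝ, 0 < C ∧ ∀ d : ℕ, 1 ≤ d → ∀ ε : ℝ, 0 < ε → ε < 1 →
    ((N d ε : ℕ∞) : ℝ≥0∞) ≤ ENNReal.ofReal (C * ε ^ (-(p + δ)))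

/-! ### Decay of the parameters -/

/-- The rate of decay of the scale and shape parameters,
`sup {β > 0 | ∑ (α_l γ_l)^(1/β) < ∞}` in `[0, ∞]`, where `sup ∅ = 0`. -/
def decayRate (α γ : ℕ → ℝ) : ℝ≥0∞ :=
  ⨆ (β : ℝ) (_ : 0 < β) (_ : Summable (fun l => (α l * γ l) ^ (1 / β))), ENNReal.ofReal β

/-- The sum of `(b_j / g²)^s` over all `j ≥ 1` with `b_j > 0`; the largest term `b_0` is left out.
(Terms with `b_j = 0` matter only if `s = 0`.) -/
def tailSum (b : ℕ → ℝ) (g s : ℝ) : ℝ≥0∞ :=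
  ∑' j : ℕ, if 0 < b (j + 1) then ENNReal.ofReal ((b (j + 1) / g ^ 2) ^ s) else 0

end KernelApprox

end

/-!
The idea. A kernel is represented by a feature map `Φ` into a Hilbert space `E`
(`IsFeatureMap`): the function of `v : E` is `x ↦ ⟪v, Φ x⟫`, and the embedding into `L²(μ)` becomes
an operator `J : E → L²(μ)`. The trace condition makes `J` Hilbert–Schmidt, so the spectral theorem
gives a Hilbert basis `b` of eigenvectors of `J⋆ J` (`exists_diagonalizes`); its eigenvalues
`‖J (b i)‖ ^ 2` are called weights. They determine the minimal errors: projecting onto the basis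
vectors with weights above `θ` gives `e(n) ≤ √θ` if there are at most `n` of them
(`minimalError_card_le`), and if there are more than `n`, then any `n` functionals vanish at a unit
vector of large `L²` norm (`le_minimalError`). All feature maps of one kernel are equivalent for
this purpose (`exists_isometry_kernelSection`), so `H d` may be replaced by an `ℓ²` space over
multi-indices, in which the tensor products of univariate eigenvectors form the basis, and the
weights are the products of the univariate ones (`diagonalizes_prodSection`).

For one variable, `1 - a² + a² K` is a rank one perturbation of `a² K`. By counting dimensions of
subspaces (`Diagonalizes.finrank_le_encard`), the numbers of weights above any level `θ`, the
largest weight left out, compare with the numbers of the eigenvalues of `K` above `θ / a²`, the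
largest left out (`encard_eigenvalue_le`, `encard_le_eigenvalue`). In one direction this costs one
more weight, of size at most `C₁ (a g)²`, because the trace is `1` and the largest weight is at
least `∫∫ (1 - a² + a² K) ≥ 1 - C₁ (a g)²`. The layer cake formula turns this into bounds for sums of
powers: the sum `S τ l` of the `τ`-th powers of the normalized weights in the `l`-th variable, the
largest left out, is of the order `(α l * γ l) ^ (2 τ)`, from above if `τ` is at least `1 / (2 r)`
and from below if `τ` is at most `1 / (2 r)`, where `r` is the decay rate
(`exists_hat_weights_rpow`).

The `τ`-th powers of the normalized weights of `H d` sum up to `∏ l, (1 + S τ l)`. If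
`τ > 1 / (2 r)`, then this is at most `exp (∑ l, S τ l)`, which is bounded in `d`, and Markov's
inequality yields `e(n) ≤ C ‖I_d‖ n ^ (-1 / (2 τ))`; the other upper bounds follow because
`‖I_d‖ ≤ 1`. Conversely, a strong bound with power `p` bounds the counting functions of the weights,
hence the power sums for all `τ > p / 2`, hence `∑ l, (α l * γ l) ^ (2 τ)` if also `τ ≤ 1 / (2 r)`.
By the definition of the decay rate this is impossible for `τ < 1 / (2 r)`, so `p ≥ 1 / r`.
-/

noncomputable section

namespace KernelApprox

open Filter Topology

universe u

/-! ### Diagonalization of compact operators between Hilbert spaces -/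

section Diagonal

variable {E F ι : Type*} [NormedAddCommGroup E] [InnerProductSpace ℝ E]
  [NormedAddCommGroup F] [InnerProductSpace ℝ F]

/-- A Hilbert basis `b` diagonalizes `J` if each `b i` is an eigenvector of `J⋆ J`; the eigenvalue
is then `‖J (b i)‖ ^ 2`. -/
def Diagonalizes (b : HilbertBasis ι ℝ E) (J : E →L[ℝ] F) : Prop :=
  ∀ i v, inner ℝ (J (b i)) (J v) = ‖J (b i)‖ ^ 2 * inner ℝ (b i) v

theorem diagonalizes_of_pairwise {b : HilbertBasis ι ℝ E} {J : E →L[ℝ] F}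
    (h : ∀ i k, i ≠ k → inner ℝ (J (b i)) (J (b k)) = 0) : Diagonalizes b J := by
  intro i v
  have h1 : HasSum (fun k => b.repr v k * inner ℝ (J (b i)) (J (b k)))
      (inner ℝ (J (b i)) (J v)) := by
    have := (b.hasSum_repr v).mapL ((innerSL ℝ (J (b i))).comp J)
    simpa [inner_smul_right] using this
  have h2 := hasSum_single (f := fun k => b.repr v k * inner ℝ (J (b i)) (J (b k))) i
    (fun k hk => by simp [h i k hk.symm])
  rw [h1.unique h2, real_inner_self_eq_norm_sq, b.repr_apply_apply, mul_comm]

theorem Diagonalizes.hasSum_norm_sq {b : HilbertBasis ι ℝ E} {J : E →L[ℝ] F}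
    (h : Diagonalizes b J) (v : E) :
    HasSum (fun i => ‖J (b i)‖ ^ 2 * (inner ℝ (b i) v) ^ 2) (‖J v‖ ^ 2) := by
  have := (b.hasSum_repr v).mapL ((innerSL ℝ (J v)).comp J)
  simp only [ContinuousLinearMap.comp_apply, innerSL_apply_apply,
    real_inner_self_eq_norm_sq, map_smul, smul_eq_mul] at this
  convert! this using 2 with i
  rw [real_inner_comm (J (b i)) (J v), h i v, b.repr_apply_apply]
  ring

theorem hasSum_inner_sq (b : HilbertBasis ι ℝ E) (v : E) :
    HasSum (fun i => (inner ℝ (b i) v) ^ 2) (‖v‖ ^ 2) := by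
  have := b.hasSum_inner_mul_inner v v
  rw [real_inner_self_eq_norm_sq] at this
  convert! this using 2 with i
  rw [real_inner_comm (b i) v, sq]

/-- If the weights are at most `θ` at all coordinates of `v` that do not vanish, then
`‖J v‖ ^ 2 ≤ θ ‖v‖ ^ 2`. -/
theorem Diagonalizes.norm_sq_le {b : HilbertBasis ι ℝ E} {J : E →L[ℝ] F}
    (h : Diagonalizes b J) {θ : ℝ} {v : E}
    (hv : ∀ i, inner ℝ (b i) v ≠ 0 → ‖J (b i)‖ ^ 2 ≤ θ) : ‖J v‖ ^ 2 ≤ θ * ‖v‖ ^ 2 := by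
  refine hasSum_le (fun i => ?_) (h.hasSum_norm_sq v) ((hasSum_inner_sq b v).mul_left θ)
  by_cases h0 : inner ℝ (b i) v = 0
  · simp [h0]
  · exact mul_le_mul_of_nonneg_right (hv i h0) (sq_nonneg _)

/-- If the weights are at least `θ` at all coordinates of `v` that do not vanish, then
`θ ‖v‖ ^ 2 ≤ ‖J v‖ ^ 2`. -/
theorem Diagonalizes.le_norm_sq {b : HilbertBasis ι ℝ E} {J : E →L[ℝ] F}
    (h : Diagonalizes b J) {θ : ℝ} {v : E}
    (hv : ∀ i, inner ℝ (b i) v ≠ 0 → θ ≤ ‖J (b i)‖ ^ 2) : θ * ‖v‖ ^ 2 ≤ ‖J v‖ ^ 2 := by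
  refine hasSum_le (fun i => ?_) ((hasSum_inner_sq b v).mul_left θ) (h.hasSum_norm_sq v)
  by_cases h0 : inner ℝ (b i) v = 0
  · simp [h0]
  · exact mul_le_mul_of_nonneg_right (hv i h0) (sq_nonneg _)

/-- A Hilbert–Schmidt operator is compact. -/
theorem isCompactOperator_of_summable [CompleteSpace F] (b : HilbertBasis ι ℝ E)
    (J : E →L[ℝ] F) (h : Summable fun i => ‖J (b i)‖ ^ 2) : IsCompactOperator J := by
  classical
  -- `J` is the limit, in operator norm, of its restrictions to finitely many coordinates.
  let G : Finset ι → E →L[ℝ] F := fun s =>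
    ∑ i ∈ s, (innerSL ℝ (b i)).smulRight (J (b i))
  have hG : ∀ s v, G s v = ∑ i ∈ s, (inner ℝ (b i) v) • J (b i) := by
    intro s v; simp [G]
  have hlim : ∀ v, Tendsto (fun s => G s v) atTop (𝓝 (J v)) := by
    intro v
    have := (b.hasSum_repr v).mapL J
    simp only [map_smul, b.repr_apply_apply] at this
    simpa only [hG] using! this
  refine isCompactOperator_of_tendsto (l := atTop) (F := G) ?_ (Eventually.of_forall fun s => ?_)
  · rw [Metric.tendsto_atTop]
    intro ε hε
    obtain ⟨s, hs⟩ := summable_iff_vanishing_norm.1 h ((ε / 2) ^ 2) (by positivity)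
    refine ⟨s, fun t hst => ?_⟩
    rw [dist_eq_norm']
    refine lt_of_le_of_lt (ContinuousLinearMap.opNorm_le_bound _ (by positivity : 0 ≤ ε / 2)
      fun v => ?_) (half_lt_self hε)
    have hcl : Tendsto (fun u => ‖G u v - G t v‖) atTop (𝓝 ‖J v - G t v‖) :=
      ((hlim v).sub_const _).norm
    refine le_of_tendsto hcl ?_
    filter_upwards [eventually_ge_atTop t] with u hu
    have h1 : G u v - G t v = ∑ i ∈ u \ t, (inner ℝ (b i) v) • J (b i) := by
      rw [hG, hG, ← Finset.sum_sdiff hu, add_sub_cancel_right]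
    have h2 : ∑ i ∈ u \ t, ‖J (b i)‖ ^ 2 ≤ (ε / 2) ^ 2 := by
      have := hs (u \ t) (Finset.disjoint_of_subset_right hst Finset.sdiff_disjoint)
      exact (le_abs_self _).trans this.le
    have h3 : ∑ i ∈ u \ t, |inner ℝ (b i) v| ^ 2 ≤ ‖v‖ ^ 2 :=
      b.orthonormal.sum_inner_products_le v
    rw [h1]
    refine (norm_sum_le _ _).trans ?_
    refine abs_le_of_sq_le_sq' ?_ (by positivity) |>.2
    calc (∑ i ∈ u \ t, ‖(inner ℝ (b i) v) • J (b i)‖) ^ 2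
        = (∑ i ∈ u \ t, |inner ℝ (b i) v| * ‖J (b i)‖) ^ 2 := by simp [norm_smul]
      _ ≤ (∑ i ∈ u \ t, |inner ℝ (b i) v| ^ 2) * ∑ i ∈ u \ t, ‖J (b i)‖ ^ 2 :=
          Finset.sum_mul_sq_le_sq_mul_sq _ _ _
      _ ≤ ‖v‖ ^ 2 * (ε / 2) ^ 2 := by gcongr
      _ = (ε / 2 * ‖v‖) ^ 2 := by ring
  · have : G s ∈ compactOperator (RingHom.id ℝ) E F := by
      refine Submodule.sum_mem _ fun i _ => ?_
      have h1 : IsCompactOperator (innerSL ℝ (b i)) :=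
        isCompactOperator_of_locallyCompactSpace_dom (innerSL ℝ (b i))
      exact h1.clm_comp (ContinuousLinearMap.toSpanSingleton ℝ (J (b i)))
    exact this

/-- Every compact operator between Hilbert spaces is diagonalized by some Hilbert basis. -/
theorem exists_diagonalizes {E : Type u} [NormedAddCommGroup E] [InnerProductSpace ℝ E]
    [CompleteSpace E] [CompleteSpace F] {J : E →L[ℝ] F} (hJ : IsCompactOperator J) :
    ∃ (ι : Type u) (b : HilbertBasis ι ℝ E), Diagonalizes b J := by
  let T : E →L[ℝ] E := J.adjoint.comp J
  have hT : ∀ u v, inner ℝ (T u) v = inner ℝ (J u) (J v) := fun u v => by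
    simp [T, ContinuousLinearMap.adjoint_inner_left]
  have hsymm : T.IsSymmetric := fun u v => by
    have h1 := hT u v
    have h2 := hT v u
    rw [real_inner_comm (J u) (J v)] at h2
    calc inner ℝ (T u) v = inner ℝ (T v) u := h1.trans h2.symm
      _ = inner ℝ u (T v) := real_inner_comm _ _
  have hcomp : IsCompactOperator T := hJ.clm_comp J.adjoint
  have hbot := ContinuousLinearMap.orthogonalComplement_iSup_eigenspaces_eq_bot hcomp hsymm
  have hclosed : ∀ c : ℝ, IsClosed (Module.End.eigenspace (T : Module.End ℝ E) c : Set E) := by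
    intro c
    have : (Module.End.eigenspace (T : Module.End ℝ E) c : Set E) = {v | T v = c • v} := by
      ext v; simp
    rw [this]
    exact isClosed_eq T.continuous (continuous_const_smul c)
  have hcs : ∀ c : ℝ, CompleteSpace (Module.End.eigenspace (T : Module.End ℝ E) c) :=
    fun c => (hclosed c).completeSpace_coe
  choose w β hβ using fun c : ℝ =>
    exists_hilbertBasis ℝ (Module.End.eigenspace (T : Module.End ℝ E) c)
  have hort : Orthonormal ℝ fun a : Σ c : ℝ, w c => (β a.1 a.2 : E) :=
    hsymm.orthogonalFamily_eigenspaces.orthonormal_sigma_orthonormal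
      (fun c => (β c).orthonormal)
  -- A vector orthogonal to all the basis vectors is orthogonal to every eigenspace.
  have hspan : (Submodule.span ℝ (Set.range fun a : Σ c : ℝ, w c => (β a.1 a.2 : E)))ᗮ = ⊥ := by
    rw [eq_bot_iff, ← hbot]
    intro v hv
    rw [Submodule.mem_orthogonal] at hv
    rw [← Submodule.iInf_orthogonal, Submodule.mem_iInf]
    intro c
    rw [Submodule.mem_orthogonal]
    intro u hu
    have h1 := ((β c).hasSum_repr ⟨u, hu⟩).mapL
      ((innerSL ℝ v).comp (Module.End.eigenspace (T : Module.End ℝ E) c).subtypeL)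
    have h0 : ∀ i, inner ℝ v (β c i : E) = 0 := fun i => by
      rw [real_inner_comm]
      exact hv _ (Submodule.subset_span ⟨⟨c, i⟩, rfl⟩)
    simp [h0] at h1
    rw [real_inner_comm]
    exact (h1.unique hasSum_zero)
  refine ⟨(Σ c : ℝ, w c), HilbertBasis.mkOfOrthogonalEqBot hort hspan, ?_⟩
  rintro ⟨c, i⟩ v
  have hb : (HilbertBasis.mkOfOrthogonalEqBot hort hspan) ⟨c, i⟩ = (β c i : E) := by
    rw [HilbertBasis.coe_mkOfOrthogonalEqBot]
  have he : T (β c i : E) = c • (β c i : E) := Module.End.mem_eigenspace_iff.1 (β c i).2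
  have h1 : ∀ v, inner ℝ (J (β c i)) (J v) = c * inner ℝ (β c i : E) v := fun v => by
    rw [← hT, he, real_inner_smul_left]
  have h2 : ‖J (β c i)‖ ^ 2 = c := by
    rw [← real_inner_self_eq_norm_sq, h1, real_inner_self_eq_norm_sq]
    have : ‖β c i‖ = 1 := (β c).orthonormal.1 i
    rw [Submodule.coe_norm] at this
    simp [this]
  rw [hb, h2, h1]

end Diagonal

/-! ### Feature maps and their embeddings into `L²` -/

section Feature

variable {E X : Type*} [NormedAddCommGroup E] [InnerProductSpace ℝ E] [MeasurableSpace X]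
  {μ : Measure X} {Φ : X → E}

/-- A feature map into a Hilbert space: `Φ` is weakly measurable and `‖Φ‖ ^ 2` is integrable.
It represents the kernel `(x, t) ↦ ⟪Φ x, Φ t⟫`, and a vector `v` stands for the function
`x ↦ ⟪v, Φ x⟫`. -/
structure IsFeatureMap (μ : Measure X) (Φ : X → E) : Prop where
  measurable_inner : ∀ v, Measurable fun x => inner ℝ v (Φ x)
  integrable_norm_sq : Integrable (fun x => ‖Φ x‖ ^ 2) μ

/-- Weak measurability only has to be checked on a set with dense span, since pointwise limits of
sequences are measurable. No separability is needed. -/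
theorem measurable_inner_of_dense {s : Set E}
    (hs : (Submodule.span ℝ s).topologicalClosure = ⊤)
    (h : ∀ v ∈ s, Measurable fun x => inner ℝ v (Φ x)) (v : E) :
    Measurable fun x => inner ℝ v (Φ x) := by
  have hspan : ∀ v ∈ Submodule.span ℝ s, Measurable fun x => inner ℝ v (Φ x) := by
    intro v hv
    induction hv using Submodule.span_induction with
    | mem v hv => exact h v hv
    | zero => simp
    | add u v _ _ hu hv =>
      simp only [inner_add_left]
      exact hu.add hv
    | smul c v _ hv => simpa only [real_inner_smul_left] using hv.const_mul c
  have hv : v ∈ closure (Submodule.span ℝ s : Set E) := by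
    rw [← Submodule.topologicalClosure_coe, hs]; trivial
  obtain ⟨u, hu, hlim⟩ := mem_closure_iff_seq_limit.1 hv
  refine measurable_of_tendsto_metrizable (fun n => hspan (u n) (hu n)) ?_
  rw [tendsto_pi_nhds]
  exact fun x => hlim.inner tendsto_const_nhds

theorem inner_toLp {f g : X → ℝ} (hf : MemLp f 2 μ) (hg : MemLp g 2 μ) :
    inner ℝ (hf.toLp f) (hg.toLp g) = ∫ x, f x * g x ∂μ := by
  rw [L2.inner_def]
  refine integral_congr_ae ?_
  filter_upwards [hf.coeFn_toLp, hg.coeFn_toLp] with x h1 h2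
  rw [h1, h2]
  simp [mul_comm]

namespace IsFeatureMap

theorem memLp (h : IsFeatureMap μ Φ) (v : E) : MemLp (fun x => inner ℝ v (Φ x)) 2 μ := by
  rw [memLp_two_iff_integrable_sq (h.measurable_inner v).aestronglyMeasurable]
  refine (h.integrable_norm_sq.const_mul (‖v‖ ^ 2)).mono'
    ((h.measurable_inner v).pow_const 2).aestronglyMeasurable (ae_of_all _ fun x => ?_)
  rw [Real.norm_eq_abs, abs_of_nonneg (sq_nonneg _), ← mul_pow, ← sq_abs]
  gcongr
  exact abs_real_inner_le_norm _ _

/-- The operator that sends `v` to the class of the function `x ↦ ⟪v, Φ x⟫` in `L²(μ)`. -/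
def toL2 (h : IsFeatureMap μ Φ) : E →L[ℝ] Lp ℝ 2 μ :=
  LinearMap.mkContinuous
    { toFun := fun v => (h.memLp v).toLp _
      map_add' := fun u v => by
        rw [← MemLp.toLp_add (h.memLp u) (h.memLp v)]
        congr 1
        ext x
        simp [inner_add_left]
      map_smul' := fun c v => by
        rw [RingHom.id_apply, ← MemLp.toLp_const_smul c (h.memLp v)]
        congr 1
        ext x
        simp [real_inner_smul_left] }
    (√(∫ x, ‖Φ x‖ ^ 2 ∂μ)) fun v => by
      refine abs_le_of_sq_le_sq' ?_ (by positivity) |>.2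
      rw [mul_pow, Real.sq_sqrt (integral_nonneg fun x => sq_nonneg _),
        ← real_inner_self_eq_norm_sq, mul_comm, ← integral_const_mul]
      simp only [LinearMap.coe_mk, AddHom.coe_mk]
      rw [inner_toLp]
      refine integral_mono_of_nonneg (ae_of_all _ fun x => mul_self_nonneg _)
        (h.integrable_norm_sq.const_mul _) (ae_of_all _ fun x => ?_)
      simp only
      rw [← mul_pow, ← sq, ← sq_abs]
      gcongr
      exact abs_real_inner_le_norm _ _

theorem toL2_apply (h : IsFeatureMap μ Φ) (v : E) : h.toL2 v = (h.memLp v).toLp _ := rfl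

theorem inner_toL2 (h : IsFeatureMap μ Φ) (u v : E) :
    inner ℝ (h.toL2 u) (h.toL2 v) = ∫ x, inner ℝ u (Φ x) * inner ℝ v (Φ x) ∂μ :=
  inner_toLp (h.memLp u) (h.memLp v)

theorem norm_toL2_sq (h : IsFeatureMap μ Φ) (v : E) :
    ‖h.toL2 v‖ ^ 2 = ∫ x, (inner ℝ v (Φ x)) ^ 2 ∂μ := by
  rw [← real_inner_self_eq_norm_sq, inner_toL2]
  simp only [sq]

theorem eLpNorm_inner (h : IsFeatureMap μ Φ) (v : E) :
    eLpNorm (fun x => inner ℝ v (Φ x)) 2 μ = ENNReal.ofReal ‖h.toL2 v‖ := by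
  rw [toL2_apply, Lp.norm_toLp, ENNReal.ofReal_toReal (h.memLp v).eLpNorm_ne_top]

/-- The squares of the singular numbers sum up to at most the trace of the kernel. -/
theorem sum_norm_toL2_sq_le (h : IsFeatureMap μ Φ) {ι : Type*} {e : ι → E}
    (he : Orthonormal ℝ e) (s : Finset ι) :
    ∑ i ∈ s, ‖h.toL2 (e i)‖ ^ 2 ≤ ∫ x, ‖Φ x‖ ^ 2 ∂μ := by
  simp only [norm_toL2_sq]
  rw [← integral_finsetSum _ fun i _ => (h.memLp (e i)).integrable_sq]
  refine integral_mono (integrable_finsetSum _ fun i _ => (h.memLp (e i)).integrable_sq)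
    h.integrable_norm_sq fun x => ?_
  simpa using he.sum_inner_products_le (Φ x) (s := s)

theorem summable_norm_toL2_sq (h : IsFeatureMap μ Φ) {ι : Type*} {e : ι → E}
    (he : Orthonormal ℝ e) : Summable fun i => ‖h.toL2 (e i)‖ ^ 2 :=
  summable_of_sum_le (fun _ => sq_nonneg _) (h.sum_norm_toL2_sq_le he)

theorem isCompactOperator_toL2 [CompleteSpace E] (h : IsFeatureMap μ Φ) :
    IsCompactOperator h.toL2 := by
  obtain ⟨w, b, -⟩ := exists_hilbertBasis ℝ E
  exact isCompactOperator_of_summable b _ (h.summable_norm_toL2_sq b.orthonormal)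

end IsFeatureMap

theorem IsFeatureMap.integrable_inner [IsFiniteMeasure μ] (h : IsFeatureMap μ Φ)
    (hm : Measurable fun z : X × X => inner ℝ (Φ z.1) (Φ z.2)) :
    Integrable (fun z : X × X => inner ℝ (Φ z.1) (Φ z.2)) (μ.prod μ) := by
  have h2 : Integrable (fun z : X × X => ‖Φ z.1‖ ^ 2 + ‖Φ z.2‖ ^ 2) (μ.prod μ) :=
    (h.integrable_norm_sq.comp_fst μ).add (h.integrable_norm_sq.comp_snd μ)
  refine h2.mono' hm.aestronglyMeasurable (ae_of_all _ fun z => ?_)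
  have h3 := abs_real_inner_le_norm (Φ z.1) (Φ z.2)
  rw [Real.norm_eq_abs]
  nlinarith [sq_nonneg (‖Φ z.1‖ - ‖Φ z.2‖), norm_nonneg (Φ z.1), norm_nonneg (Φ z.2)]

/-- For a probability measure, the integral of the kernel is at most the largest eigenvalue. -/
theorem IsFeatureMap.integral_inner_le [CompleteSpace E] [IsProbabilityMeasure μ]
    (h : IsFeatureMap μ Φ) {θ : ℝ} (hθ0 : 0 ≤ θ)
    (hθ : ∀ v, ‖h.toL2 v‖ ^ 2 ≤ θ * ‖v‖ ^ 2)
    (hm : Measurable fun z : X × X => inner ℝ (Φ z.1) (Φ z.2)) :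
    ∫ z : X × X, inner ℝ (Φ z.1) (Φ z.2) ∂(μ.prod μ) ≤ θ := by
  have h1 : MemLp (fun _ : X => (1 : ℝ)) 2 μ := memLp_const 1
  set g : Lp ℝ 2 μ := h1.toLp with hg
  set u : E := h.toL2.adjoint g with hu
  have hgn : ‖g‖ ^ 2 = 1 := by
    rw [← real_inner_self_eq_norm_sq, hg, inner_toLp]; simp
  have hint := h.integrable_inner hm
  have hux : ∀ x, inner ℝ u (Φ x) = ∫ t, inner ℝ (Φ x) (Φ t) ∂μ := fun x => by
    rw [hu, ContinuousLinearMap.adjoint_inner_left, real_inner_comm, hg, IsFeatureMap.toL2_apply,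
      inner_toLp]
    simp
  have hI : ∫ z : X × X, inner ℝ (Φ z.1) (Φ z.2) ∂(μ.prod μ) = ‖u‖ ^ 2 := by
    rw [integral_prod _ hint]
    simp only [← hux]
    rw [← real_inner_self_eq_norm_sq]
    conv_rhs => rw [hu, ContinuousLinearMap.adjoint_inner_left, ← hu, hg,
      IsFeatureMap.toL2_apply, inner_toLp]
    simp
  rw [hI]
  have h4 : ‖u‖ ^ 2 ≤ ‖h.toL2 u‖ := by
    have : ‖u‖ ^ 2 = inner ℝ g (h.toL2 u) := by
      rw [← ContinuousLinearMap.adjoint_inner_left, ← hu, real_inner_self_eq_norm_sq]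
    rw [this]
    refine (real_inner_le_norm _ _).trans ?_
    have : ‖g‖ = 1 := by nlinarith [norm_nonneg g]
    rw [this, one_mul]
  have h5 := hθ u
  by_cases hu0 : ‖u‖ ^ 2 = 0
  · rwa [hu0]
  · have hpos : 0 < ‖u‖ ^ 2 := lt_of_le_of_ne (sq_nonneg _) (Ne.symm hu0)
    have h6 : (‖u‖ ^ 2) ^ 2 ≤ θ * ‖u‖ ^ 2 := (pow_le_pow_left₀ hpos.le h4 2).trans h5
    nlinarith

end Feature

/-! ### Reproducing kernel Hilbert spaces and their feature maps -/

section Kernel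

variable {X : Type*} (H : Type*) [NormedAddCommGroup H] [InnerProductSpace ℝ H]
  [RKHS ℝ H X ℝ] [CompleteSpace H]

/-- The canonical feature map of `H`: the representer of the evaluation at `x`. -/
def kernelSection (x : X) : H := RKHS.kerFun H x (1 : ℝ)

variable {H} in
theorem inner_kernelSection (f : H) (x : X) : inner ℝ f (kernelSection H x) = f x := by
  simp [kernelSection]

theorem inner_kernelSection_kernelSection (x t : X) :
    inner ℝ (kernelSection H x) (kernelSection H t) = reproducingKernel H x t := by
  rw [real_inner_comm, inner_kernelSection, kernelSection, RKHS.kerFun_apply, reproducingKernel]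

theorem span_kernelSection :
    (Submodule.span ℝ (Set.range (kernelSection H (X := X)))).topologicalClosure = ⊤ := by
  rw [← RKHS.kerFun_dense H]
  congr 1
  refine le_antisymm (Submodule.span_mono ?_) (Submodule.span_le.2 ?_)
  · rintro _ ⟨x, rfl⟩
    exact ⟨x, 1, rfl⟩
  · rintro _ ⟨x, v, rfl⟩
    have : RKHS.kerFun H x v = v • kernelSection H x := by
      rw [kernelSection, ← map_smul, smul_eq_mul, mul_one]
    rw [this]
    exact Submodule.smul_mem _ _ (Submodule.subset_span ⟨x, rfl⟩)

theorem isFeatureMap_kernelSection [MeasurableSpace X] {μ : Measure X}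
    (hm : Measurable fun z : X × X => reproducingKernel H z.1 z.2)
    (hi : Integrable (fun x => reproducingKernel H x x) μ) :
    IsFeatureMap μ (kernelSection H (X := X)) where
  measurable_inner := measurable_inner_of_dense (span_kernelSection H) (by
    rintro _ ⟨x, rfl⟩
    simp only [inner_kernelSection_kernelSection]
    have h : Measurable (Function.uncurry fun x t => reproducingKernel H x t) := hm
    exact h.of_uncurry_left)
  integrable_norm_sq := by
    simpa only [← real_inner_self_eq_norm_sq, inner_kernelSection_kernelSection] using hi

/-- Any other feature map of the kernel of `H` factors through an isometric embedding of `H`. -/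
theorem exists_isometry_kernelSection {E : Type*} [NormedAddCommGroup E] [InnerProductSpace ℝ E]
    [CompleteSpace E] {Φ : X → E} (hΦ : ∀ x t, inner ℝ (Φ x) (Φ t) = reproducingKernel H x t) :
    ∃ U : H →ₗᵢ[ℝ] E, ∀ x, U (kernelSection H x) = Φ x := by
  let e : (X →₀ ℝ) →ₗ[ℝ] H := Finsupp.linearCombination ℝ (kernelSection H)
  let f : (X →₀ ℝ) →ₗ[ℝ] E := Finsupp.linearCombination ℝ Φ
  have hd : DenseRange e := by
    have h1 := span_kernelSection H (X := X)
    rw [← Finsupp.range_linearCombination] at h1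
    exact Submodule.dense_iff_topologicalClosure_eq_top.2 h1
  have hinner : ∀ c, ‖f c‖ ^ 2 = ‖e c‖ ^ 2 := fun c => by
    rw [← real_inner_self_eq_norm_sq, ← real_inner_self_eq_norm_sq]
    simp only [e, f, Finsupp.linearCombination_apply, Finsupp.sum_inner, Finsupp.inner_sum,
      real_inner_smul_left, real_inner_smul_right, hΦ, inner_kernelSection_kernelSection]
  have hnorm : ∀ c, ‖f c‖ = ‖e c‖ := fun c =>
    (pow_left_inj₀ (norm_nonneg _) (norm_nonneg _) two_ne_zero).1 (hinner c)
  have hb : ∃ C : ℝ, ∀ c, ‖f c‖ ≤ C * ‖e c‖ := ⟨1, fun c => by rw [hnorm, one_mul]⟩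
  refine ⟨⟨(f.extendOfNorm e).toLinearMap, fun v => ?_⟩, fun x => ?_⟩
  · refine hd.induction (P := fun v => ‖f.extendOfNorm e v‖ = ‖v‖) ?_
      (isClosed_eq (by fun_prop) (by fun_prop)) v
    rintro _ ⟨c, rfl⟩
    rw [LinearMap.extendOfNorm_eq hd hb, hnorm]
  · have h1 := LinearMap.extendOfNorm_eq hd hb (Finsupp.single x 1)
    simpa [e, f] using h1

end Kernel

/-! ### Minimal errors in terms of a diagonalization -/

section MinimalError

variable {X : Type*} [MeasurableSpace X] {μ : Measure X} (H : Type*) [NormedAddCommGroup H]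
  [InnerProductSpace ℝ H] [RKHS ℝ H X ℝ]

theorem minimalError_zero : minimalError H μ 0 = embeddingNorm H μ := by
  have : ∀ (L : Fin 0 → H →L[ℝ] ℝ) (a : Fin 0 → X → ℝ),
      worstCaseError μ (linearAlgorithm L a) = embeddingNorm H μ := fun L a => by
    simp [worstCaseError, embeddingNorm, linearAlgorithm]
  simp [minimalError, this]

theorem minimalError_antitone : Antitone (minimalError H μ) := by
  intro m n hmn
  obtain ⟨k, rfl⟩ := Nat.exists_eq_add_of_le hmn
  refine le_iInf fun L => le_iInf fun a => le_iInf fun ha => ?_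
  refine iInf_le_of_le (Fin.append L 0) (iInf_le_of_le (Fin.append a 0)
    (iInf_le_of_le (fun j => ?_) (le_of_eq ?_)))
  · refine Fin.addCases (fun i => ?_) (fun i => ?_) j
    · simpa using ha i
    · simp
  · congr 1
    ext f x
    simp [linearAlgorithm, Fin.sum_univ_add]

variable [CompleteSpace H] {E ι : Type*} [NormedAddCommGroup E] [InnerProductSpace ℝ E]
  {Φ : X → E}

theorem inner_span_eq_zero (b : HilbertBasis ι ℝ E) {A : Set ι} {v : E}
    (hv : v ∈ Submodule.span ℝ (Set.range fun i : A => b i)) {i : ι} (hi : i ∉ A) :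
    inner ℝ (b i) v = 0 := by
  induction hv using Submodule.span_induction with
  | mem v hv =>
    obtain ⟨k, rfl⟩ := hv
    exact b.orthonormal.2 fun h => hi (h ▸ k.2)
  | zero => simp
  | add u v _ _ hu hv => simp [inner_add_right, hu, hv]
  | smul c v _ hv => simp [inner_smul_right, hv]

theorem finrank_span_basis (b : HilbertBasis ι ℝ E) (A : Set ι) [Fintype A] :
    Module.finrank ℝ (Submodule.span ℝ (Set.range fun i : A => b i)) = Fintype.card A :=
  finrank_span_eq_card (b.orthonormal.comp _ Subtype.val_injective).linearIndependent

/-- Projecting onto the basis vectors in `A`, whose coefficients are `A.card` functionals, leaves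
an error governed by the largest weight outside of `A`. -/
theorem minimalError_card_le [CompleteSpace E] (hΦ : IsFeatureMap μ Φ)
    (hK : ∀ x t, inner ℝ (Φ x) (Φ t) = reproducingKernel H x t)
    {b : HilbertBasis ι ℝ E} (hb : Diagonalizes b hΦ.toL2) {A : Finset ι} {θ : ℝ} (hθ : 0 ≤ θ)
    (hA : ∀ i ∉ A, ‖hΦ.toL2 (b i)‖ ^ 2 ≤ θ) :
    minimalError H μ A.card ≤ ENNReal.ofReal √θ := by
  classical
  obtain ⟨U, hU⟩ := exists_isometry_kernelSection H hK
  have hUf : ∀ (f : H) x, inner ℝ (U f) (Φ x) = f x := fun f x => by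
    rw [← hU, U.inner_map_map, inner_kernelSection]
  let e := A.equivFin.symm
  refine iInf_le_of_le (fun j => (innerSL ℝ (b (e j))).comp U.toContinuousLinearMap)
    (iInf_le_of_le (fun j x => inner ℝ (b (e j)) (Φ x))
      (iInf_le_of_le (fun j => hΦ.memLp _) ?_))
  refine iSup_le fun f => iSup_le fun hf => ?_
  set v : E := U f - ∑ i ∈ A, (inner ℝ (b i) (U f)) • b i with hv
  have h1 : (fun x => f x - linearAlgorithm
      (fun j => (innerSL ℝ (b (e j))).comp U.toContinuousLinearMap)
      (fun j x => inner ℝ (b (e j)) (Φ x)) f x) = fun x => inner ℝ v (Φ x) := by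
    ext x
    have : linearAlgorithm (fun j => (innerSL ℝ (b (e j))).comp U.toContinuousLinearMap)
        (fun j x => inner ℝ (b (e j)) (Φ x)) f x
        = ∑ i ∈ A, inner ℝ (b i) (U f) * inner ℝ (b i) (Φ x) := by
      rw [← Finset.sum_coe_sort A, ← e.sum_comp]
      simp [linearAlgorithm]
    rw [this, hv, inner_sub_left, hUf, sum_inner]
    simp [real_inner_smul_left]
  rw [h1, hΦ.eLpNorm_inner]
  refine ENNReal.ofReal_le_ofReal (Real.le_sqrt_of_sq_le ?_)
  have hvi : ∀ i, inner ℝ (b i) v = if i ∈ A then 0 else inner ℝ (b i) (U f) := fun i => by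
    rw [hv, inner_sub_right, inner_sum]
    simp [inner_smul_right, orthonormal_iff_ite.1 b.orthonormal]
    split_ifs <;> simp
  have h2 : ‖v‖ ^ 2 ≤ 1 := by
    have h3 : ‖v‖ ^ 2 ≤ ‖U f‖ ^ 2 := by
      refine hasSum_le (fun i => ?_) (hasSum_inner_sq b v) (hasSum_inner_sq b (U f))
      rw [hvi]
      split_ifs
      · simpa using sq_nonneg _
      · exact le_rfl
    rw [U.norm_map] at h3
    exact h3.trans (pow_le_one₀ (norm_nonneg _) hf)
  refine (hb.norm_sq_le (θ := θ) fun i hi => hA i fun hiA => hi (by simp [hvi, hiA])).trans ?_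
  exact mul_le_of_le_one_right hθ h2

/-- If more than `n` weights are at least `θ`, then any `n` functionals vanish at some unit vector
in the span of the basis vectors concerned, whose `L²` norm is at least `√θ`. -/
theorem le_minimalError [CompleteSpace E] (hΦ : IsFeatureMap μ Φ)
    (hK : ∀ x t, inner ℝ (Φ x) (Φ t) = reproducingKernel H x t)
    {b : HilbertBasis ι ℝ E} (hb : Diagonalizes b hΦ.toL2) {A : Finset ι} {θ : ℝ}
    (hA : ∀ i ∈ A, θ ≤ ‖hΦ.toL2 (b i)‖ ^ 2) {n : ℕ} (hn : n < A.card) :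
    ENNReal.ofReal √θ ≤ minimalError H μ n := by
  classical
  obtain ⟨U, hU⟩ := exists_isometry_kernelSection H hK
  let V : E →L[ℝ] H := U.toContinuousLinearMap.adjoint
  have hVx : ∀ c x, V c x = inner ℝ c (Φ x) := fun c x => by
    rw [← inner_kernelSection, ContinuousLinearMap.adjoint_inner_left, ← hU]
    rfl
  have hVn : ∀ c, ‖V c‖ ≤ ‖c‖ := fun c => by
    refine (V.le_opNorm c).trans (mul_le_of_le_one_left (norm_nonneg _) ?_)
    rw [LinearIsometryEquiv.norm_map]
    exact U.norm_toContinuousLinearMap_le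
  refine le_iInf fun L => le_iInf fun a => le_iInf fun _ => ?_
  let S := Submodule.span ℝ (Set.range fun i : (A : Set ι) => b i)
  have hS : Module.finrank ℝ S = A.card := (finrank_span_basis b (A : Set ι)).trans (by simp)
  have : FiniteDimensional ℝ S := FiniteDimensional.span_of_finite ℝ (Set.finite_range _)
  let M : S →ₗ[ℝ] (Fin n → ℝ) :=
    LinearMap.pi fun j => ((L j).comp V).toLinearMap.comp S.subtype
  have hM : LinearMap.ker M ≠ ⊥ := LinearMap.ker_ne_bot_of_finrank_lt (by simpa [hS] using hn)
  obtain ⟨w, hw, hw0⟩ := Submodule.exists_mem_ne_zero_of_ne_bot hM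
  have hwn : 0 < ‖(w : E)‖ := by simpa using hw0
  have hL : ∀ j, L j (V w) = 0 := fun j => congrFun (LinearMap.mem_ker.1 hw) j
  have hJ : θ * ‖(w : E)‖ ^ 2 ≤ ‖hΦ.toL2 w‖ ^ 2 := hb.le_norm_sq fun i hi => by
    by_contra hcon
    exact hi (inner_span_eq_zero b w.2 fun hiA => hcon (hA i hiA))
  set f : H := V (‖(w : E)‖⁻¹ • (w : E)) with hf
  have hf1 : ‖f‖ ≤ 1 := (hVn _).trans (by simp [norm_smul, hwn.ne'])
  refine le_trans ?_ (le_iSup₂_of_le f hf1 le_rfl)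
  have h1 : (fun x => f x - linearAlgorithm L a f x)
      = fun x => inner ℝ (‖(w : E)‖⁻¹ • (w : E)) (Φ x) := by
    ext x
    rw [hf, hVx]
    simp [linearAlgorithm, hL]
  rw [h1, hΦ.eLpNorm_inner]
  refine ENNReal.ofReal_le_ofReal (Real.sqrt_le_iff.2 ⟨norm_nonneg _, ?_⟩)
  rw [map_smul, norm_smul, mul_pow, norm_inv, norm_norm, inv_pow, ← div_eq_inv_mul,
    le_div_iff₀ (by positivity)]
  exact hJ

end MinimalError

/-! ### Counting eigenvalues by dimensions of subspaces -/

section Counting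

variable {E F ι : Type*} [NormedAddCommGroup E] [InnerProductSpace ℝ E]
  [NormedAddCommGroup F] [InnerProductSpace ℝ F] {b : HilbertBasis ι ℝ E} {J : E →L[ℝ] F}

/-- A subspace on which `J⋆ J` exceeds the level `θ` has at most as many dimensions as there are
weights above `θ`. -/
theorem Diagonalizes.finrank_le_encard (hb : Diagonalizes b J) {c θ : ℝ} (V : Submodule ℝ E)
    [FiniteDimensional ℝ V] (hV : ∀ v ∈ V, v ≠ 0 → θ * ‖v‖ ^ 2 < c * ‖J v‖ ^ 2) :
    (Module.finrank ℝ V : ℕ∞) ≤ {i | θ < c * ‖J (b i)‖ ^ 2}.encard := by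
  by_contra! hlt
  set A := {i | θ < c * ‖J (b i)‖ ^ 2} with hA
  have hfin : A.Finite := Set.finite_of_encard_le_coe hlt.le
  have := hfin.fintype
  rw [← Set.coe_fintypeCard, Nat.cast_lt] at hlt
  let M : V →ₗ[ℝ] (A → ℝ) :=
    LinearMap.pi fun i => (innerSL ℝ (b i)).toLinearMap.comp V.subtype
  have hM : LinearMap.ker M ≠ ⊥ := LinearMap.ker_ne_bot_of_finrank_lt (by simpa using hlt)
  obtain ⟨w, hw, hw0⟩ := Submodule.exists_mem_ne_zero_of_ne_bot hM
  have hzero : ∀ i ∈ A, inner ℝ (b i) (w : E) = 0 := fun i hi =>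
    congrFun (LinearMap.mem_ker.1 hw) ⟨i, hi⟩
  refine (hV w w.2 (by simpa using hw0)).not_ge ?_
  refine hasSum_le (fun i => ?_) ((hb.hasSum_norm_sq w).mul_left c)
    ((hasSum_inner_sq b (w : E)).mul_left θ)
  by_cases hi : i ∈ A
  · simp [hzero i hi]
  · rw [← mul_assoc]
    exact mul_le_mul_of_nonneg_right (not_lt.1 hi) (sq_nonneg _)

theorem exists_embedding_of_le_encard {s : Set ι} {n : ℕ} (h : (n : ℕ∞) ≤ s.encard) :
    ∃ e : Fin n ↪ ι, ∀ k, e k ∈ s := by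
  obtain ⟨t, hts, ht⟩ := Set.exists_subset_encard_eq h
  have hfin : t.Finite := Set.finite_of_encard_eq_coe ht
  have := hfin.fintype
  rw [← Set.coe_fintypeCard, Nat.cast_inj] at ht
  let e := (Fintype.equivFinOfCardEq ht).symm
  exact ⟨e.toEmbedding.trans (Function.Embedding.subtype _), fun k => hts (e k).2⟩

/-- Conversely, `n` weights above `θ` give an `n`-dimensional subspace on which `J⋆ J` exceeds the
level `θ`. -/
theorem Diagonalizes.exists_submodule (hb : Diagonalizes b J) {θ : ℝ} {n : ℕ}
    (h : (n : ℕ∞) ≤ {i | θ < ‖J (b i)‖ ^ 2}.encard) :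
    ∃ V : Submodule ℝ E, FiniteDimensional ℝ V ∧ Module.finrank ℝ V = n ∧
      ∀ v ∈ V, v ≠ 0 → θ * ‖v‖ ^ 2 < ‖J v‖ ^ 2 := by
  obtain ⟨t, hts, ht⟩ := Set.exists_subset_encard_eq h
  have hfin : t.Finite := Set.finite_of_encard_eq_coe ht
  have := hfin.fintype
  rw [← Set.coe_fintypeCard, Nat.cast_inj] at ht
  refine ⟨Submodule.span ℝ (Set.range fun i : t => b i),
    FiniteDimensional.span_of_finite ℝ (Set.finite_range _), (finrank_span_basis b t).trans ht,
    fun v hv hv0 => ?_⟩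
  have hne : t.Nonempty := by
    by_contra hcon
    rw [Set.not_nonempty_iff_eq_empty] at hcon
    refine hv0 ?_
    have : Set.range (fun i : t => b i) = ∅ := by
      rw [Set.range_eq_empty_iff]; exact Set.isEmpty_coe_sort.2 hcon
    rw [this] at hv
    simpa using hv
  obtain ⟨i₀, hi₀, hmin⟩ := hfin.exists_minimalFor (fun i => ‖J (b i)‖ ^ 2) t hne
  have hmin' : ∀ i ∈ t, ‖J (b i₀)‖ ^ 2 ≤ ‖J (b i)‖ ^ 2 := fun i hi =>
    (le_total _ _).elim id (hmin hi)
  calc θ * ‖v‖ ^ 2 < ‖J (b i₀)‖ ^ 2 * ‖v‖ ^ 2 := by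
        have : 0 < ‖v‖ := norm_pos_iff.2 hv0
        exact mul_lt_mul_of_pos_right (hts hi₀) (by positivity)
    _ ≤ ‖J v‖ ^ 2 := hb.le_norm_sq fun i hi => by
        by_contra hcon
        exact hi (inner_span_eq_zero b hv fun hit => hcon (hmin' i hit))

end Counting

/-! ### The eigenvalues of the integral operator -/

section Eigenvalue

variable {X : Type*} [MeasurableSpace X] {μ : Measure X} {H : Type*} [NormedAddCommGroup H]
  [InnerProductSpace ℝ H] [RKHS ℝ H X ℝ] [CompleteSpace H]

theorem IsEigenpair.inner_toL2 (h : IsFeatureMap μ (kernelSection H (X := X))) {c : ℝ} {f : H}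
    (hf : IsEigenpair H μ c f) (v : H) :
    inner ℝ (h.toL2 f) (h.toL2 v) = c * inner ℝ f v := by
  have hz : h.toL2.adjoint (h.toL2 f) = c • f := by
    refine RKHS.ext fun x => ?_
    rw [RKHS.coe_smul, ← inner_kernelSection, ContinuousLinearMap.adjoint_inner_left,
      h.inner_toL2, Pi.smul_apply, smul_eq_mul, ← hf x]
    simp only [← inner_kernelSection_kernelSection, inner_kernelSection]
  rw [← ContinuousLinearMap.adjoint_inner_left, hz, real_inner_smul_left]

theorem isEigenpair_of_inner_toL2 (h : IsFeatureMap μ (kernelSection H (X := X))) {c : ℝ} {f : H}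
    (hf : ∀ v, inner ℝ (h.toL2 f) (h.toL2 v) = c * inner ℝ f v) : IsEigenpair H μ c f := by
  intro x
  rw [← inner_kernelSection f x, ← hf, h.inner_toL2]
  simp only [← inner_kernelSection_kernelSection, inner_kernelSection]

/-- If the `j`-th eigenvalue exceeds a level, then so does the quadratic form on a subspace of
dimension `j + 1`. Positivity of `θ` excludes the junk value `0` of the supremum of the empty set. -/
theorem exists_submodule_of_lt_eigenvalue (h : IsFeatureMap μ (kernelSection H (X := X)))
    {c θ : ℝ} (hc : 0 ≤ c) (hθ : 0 < θ) {j : ℕ} (hj : θ < c * eigenvalue H μ j) :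
    ∃ V : Submodule ℝ H, FiniteDimensional ℝ V ∧ Module.finrank ℝ V = j + 1 ∧
      ∀ v ∈ V, v ≠ 0 → θ * ‖v‖ ^ 2 < c * ‖h.toL2 v‖ ^ 2 := by
  have hc0 : 0 < c := lt_of_le_of_ne hc (by rintro rfl; simp at hj; linarith)
  rw [← div_lt_iff₀' hc0] at hj
  obtain ⟨t, ⟨η, hη, hη'⟩, hct⟩ := exists_lt_of_lt_csSup (by
    by_contra hne
    rw [Set.not_nonempty_iff_eq_empty] at hne
    rw [eigenvalue, hne, Real.sSup_empty] at hj
    exact absurd hj (not_lt.2 (by positivity))) hj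
  choose β hβ hpair using hη'
  refine ⟨Submodule.span ℝ (Set.range η), FiniteDimensional.span_of_finite ℝ (Set.finite_range _),
    by simpa using finrank_span_eq_card hη.linearIndependent, fun v hv hv0 => ?_⟩
  obtain ⟨x, rfl⟩ := (Submodule.mem_span_range_iff_exists_fun ℝ).1 hv
  have h1 : ‖∑ i, x i • η i‖ ^ 2 = ∑ i, x i ^ 2 := by
    rw [← real_inner_self_eq_norm_sq, hη.inner_sum]
    simp [sq]
  have h2 : ‖h.toL2 (∑ i, x i • η i)‖ ^ 2 = ∑ i, β i * x i ^ 2 := by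
    rw [← real_inner_self_eq_norm_sq]
    conv_lhs => rw [map_sum, sum_inner]
    refine Finset.sum_congr rfl fun i _ => ?_
    rw [map_smul, real_inner_smul_left, ← map_sum, (hpair i).inner_toL2 h, hη.inner_right_fintype]
    ring
  have h3 : 0 < ∑ i, x i ^ 2 := by
    rw [← h1]
    have := norm_pos_iff.2 hv0
    positivity
  rw [h1, h2]
  calc θ * ∑ i, x i ^ 2 = c * (θ / c * ∑ i, x i ^ 2) := by field_simp
    _ < c * (t * ∑ i, x i ^ 2) := by gcongr
    _ ≤ c * ∑ i, β i * x i ^ 2 := by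
        rw [Finset.mul_sum]
        gcongr with i
        exact hβ i

/-- A subspace of dimension at least `j + 1` on which the quadratic form of the integral operator
exceeds a level bounds the `j`-th eigenvalue from below. -/
theorem lt_eigenvalue_of_finrank (h : IsFeatureMap μ (kernelSection H (X := X)))
    {c θ : ℝ} (hc : 0 ≤ c) {j : ℕ} (V : Submodule ℝ H) [FiniteDimensional ℝ V]
    (hj : j + 1 ≤ Module.finrank ℝ V)
    (hV : ∀ v ∈ V, v ≠ 0 → θ * ‖v‖ ^ 2 < c * ‖h.toL2 v‖ ^ 2) : θ < c * eigenvalue H μ j := by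
  obtain ⟨ι, b, hb⟩ := exists_diagonalizes h.isCompactOperator_toL2
  have h1 : ((j + 1 : ℕ) : ℕ∞) ≤ {i | θ < c * ‖h.toL2 (b i)‖ ^ 2}.encard :=
    le_trans (by exact_mod_cast hj) (hb.finrank_le_encard V hV)
  obtain ⟨e, he⟩ := exists_embedding_of_le_encard h1
  obtain ⟨k, hk⟩ := Finite.exists_min fun k => ‖h.toL2 (b (e k))‖ ^ 2
  have hbdd : BddAbove {t : ℝ | ∃ η : Fin (j + 1) → H, Orthonormal ℝ η ∧
      ∀ i, ∃ β : ℝ, t ≤ β ∧ IsEigenpair H μ β (η i)} := by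
    refine ⟨∫ x, ‖kernelSection H x‖ ^ 2 ∂μ, ?_⟩
    rintro t ⟨η, hη, hη'⟩
    obtain ⟨β, hβ, hp⟩ := hη' 0
    have h2 := hp.inner_toL2 h (η 0)
    rw [real_inner_self_eq_norm_sq, real_inner_self_eq_norm_sq, hη.1 0, one_pow, mul_one] at h2
    have h3 := h.sum_norm_toL2_sq_le hη {0}
    rw [Finset.sum_singleton, h2] at h3
    exact hβ.trans h3
  have hle : ‖h.toL2 (b (e k))‖ ^ 2 ≤ eigenvalue H μ j :=
    le_csSup hbdd ⟨fun i => b (e i), b.orthonormal.comp _ e.injective, fun i =>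
      ⟨_, hk i, isEigenpair_of_inner_toL2 h (hb (e i))⟩⟩
  exact (he k).trans_le (mul_le_mul_of_nonneg_left hle hc)

end Eigenvalue

/-! ### The feature map of the kernel `1 - a² + a² K` -/

section Hat

theorem norm_sq_eq_of_fst_eq_zero {H : Type*} [NormedAddCommGroup H] (v : WithLp 2 (ℝ × H))
    (hv : v.fst = 0) : ‖v‖ ^ 2 = ‖v.snd‖ ^ 2 := by
  rw [WithLp.prod_norm_sq_eq_of_L2, hv]; simp

variable {X : Type*} {H : Type*} [NormedAddCommGroup H] [InnerProductSpace ℝ H]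
  [RKHS ℝ H X ℝ] [CompleteSpace H] {a : ℝ}

variable (H) in
/-- The feature map `x ↦ (√(1 - a²), a K(x, ·))` into `ℝ ⊕ H`, where `K` is the kernel of `H`.
Its kernel is `1 - a² + a² K`. -/
def hatSection (a : ℝ) (x : X) : WithLp 2 (ℝ × H) :=
  WithLp.toLp 2 (√(1 - a ^ 2), a • kernelSection H x)

theorem inner_hatSection (v : WithLp 2 (ℝ × H)) (x : X) :
    inner ℝ v (hatSection H a x) = v.fst * √(1 - a ^ 2) + a * v.snd x := by
  simp [hatSection, WithLp.prod_inner_apply, real_inner_smul_right, inner_kernelSection, mul_comm]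

theorem inner_hatSection_hatSection (ha : 0 ≤ a ∧ a ≤ 1) (x t : X) :
    inner ℝ (hatSection H a x) (hatSection H a t)
      = 1 - a ^ 2 + a ^ 2 * reproducingKernel H x t := by
  have h1 : 0 ≤ 1 - a ^ 2 := by nlinarith
  have h2 := Real.mul_self_sqrt h1
  simp only [hatSection, WithLp.prod_inner_apply, real_inner_smul_left, real_inner_smul_right,
    inner_kernelSection_kernelSection]
  simp only [RCLike.inner_apply, conj_trivial, h2]
  ring

variable [MeasurableSpace X] {μ : Measure X}

theorem isFeatureMap_hatSection [IsProbabilityMeasure μ] (ha : 0 ≤ a ∧ a ≤ 1)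
    (h : IsFeatureMap μ (kernelSection H (X := X))) : IsFeatureMap μ (hatSection H (X := X) a) where
  measurable_inner v := by
    simp only [inner_hatSection, ← inner_kernelSection]
    exact ((h.measurable_inner _).const_mul _).const_add _
  integrable_norm_sq := by
    simp only [← real_inner_self_eq_norm_sq, inner_hatSection_hatSection ha,
      ← inner_kernelSection_kernelSection]
    simp only [real_inner_self_eq_norm_sq]
    exact (integrable_const _).add (h.integrable_norm_sq.const_mul _)

theorem norm_toL2_hatSection_sq (h : IsFeatureMap μ (kernelSection H (X := X)))
    (h' : IsFeatureMap μ (hatSection H (X := X) a)) (v : WithLp 2 (ℝ × H)) (hv : v.fst = 0) :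
    ‖h'.toL2 v‖ ^ 2 = a ^ 2 * ‖h.toL2 v.snd‖ ^ 2 := by
  rw [h'.norm_toL2_sq, h.norm_toL2_sq, ← integral_const_mul]
  simp only [inner_hatSection, hv, inner_kernelSection, zero_mul, zero_add, mul_pow]

variable {ι : Type*} {b : HilbertBasis ι ℝ (WithLp 2 (ℝ × H))}

/-- The weights of `1 - a² + a² K` dominate `a²` times the eigenvalues of `K`. -/
theorem le_encard_of_lt_eigenvalue (h : IsFeatureMap μ (kernelSection H (X := X)))
    {h' : IsFeatureMap μ (hatSection H (X := X) a)} (hb : Diagonalizes b h'.toL2) {θ : ℝ}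
    (hθ : 0 < θ) {j : ℕ} (hj : θ < a ^ 2 * eigenvalue H μ j) :
    ((j + 1 : ℕ) : ℕ∞) ≤ {i | θ < ‖h'.toL2 (b i)‖ ^ 2}.encard := by
  obtain ⟨V, hfin, hV, hlt⟩ := exists_submodule_of_lt_eigenvalue h (sq_nonneg a) hθ hj
  let g : H →ₗ[ℝ] WithLp 2 (ℝ × H) :=
    (WithLp.linearEquiv 2 ℝ (ℝ × H)).symm.toLinearMap.comp (LinearMap.inr ℝ ℝ H)
  have hg : ∀ u, (g u).fst = 0 ∧ (g u).snd = u := fun u => ⟨rfl, rfl⟩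
  have hginj : Function.Injective g := fun u v huv => by
    rw [← (hg u).2, huv, (hg v).2]
  have h1 : Module.finrank ℝ (V.map g) = j + 1 := by
    rw [← hV]
    exact (Submodule.equivMapOfInjective g hginj V).finrank_eq.symm
  have h2 := hb.finrank_le_encard (c := 1) (θ := θ) (V.map g) (by
    rintro _ ⟨u, hu, rfl⟩ hu0
    rw [one_mul, norm_sq_eq_of_fst_eq_zero _ (hg u).1, norm_toL2_hatSection_sq h h' _ (hg u).1,
      (hg u).2]
    exact hlt u hu (by rintro rfl; simp at hu0))
  rw [h1] at h2
  simpa using h2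

/-- The rank one summand `1 - a²` shifts the eigenvalues by at most one index. -/
theorem lt_eigenvalue_of_le_encard (h : IsFeatureMap μ (kernelSection H (X := X)))
    {h' : IsFeatureMap μ (hatSection H (X := X) a)} (hb : Diagonalizes b h'.toL2) {θ : ℝ}
    {j : ℕ} (hj : ((j + 2 : ℕ) : ℕ∞) ≤ {i | θ < ‖h'.toL2 (b i)‖ ^ 2}.encard) :
    θ < a ^ 2 * eigenvalue H μ j := by
  obtain ⟨V, hfin, hV, hlt⟩ := hb.exists_submodule hj
  let p : WithLp 2 (ℝ × H) →ₗ[ℝ] ℝ × H := (WithLp.linearEquiv 2 ℝ (ℝ × H)).toLinearMap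
  let q : V →ₗ[ℝ] ℝ := (LinearMap.fst ℝ ℝ H).comp (p.comp V.subtype)
  let r : LinearMap.ker q →ₗ[ℝ] H :=
    (LinearMap.snd ℝ ℝ H).comp (p.comp (V.subtype.comp (LinearMap.ker q).subtype))
  have hker : ∀ w : LinearMap.ker q, (w : WithLp 2 (ℝ × H)).fst = 0 := fun w => w.2
  have hr : ∀ w : LinearMap.ker q, r w = (w : WithLp 2 (ℝ × H)).snd := fun w => rfl
  have hrinj : Function.Injective r := by
    rw [injective_iff_map_eq_zero]
    intro w hw
    have := norm_sq_eq_of_fst_eq_zero _ (hker w)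
    rw [← hr, hw] at this
    simpa using this
  have hdim : j + 1 ≤ Module.finrank ℝ (LinearMap.range r) := by
    rw [LinearMap.finrank_range_of_inj hrinj]
    have h1 := q.finrank_range_add_finrank_ker
    have h2 : Module.finrank ℝ (LinearMap.range q) ≤ 1 := by
      simpa using Submodule.finrank_le (LinearMap.range q)
    omega
  refine lt_eigenvalue_of_finrank h (sq_nonneg a) (LinearMap.range r) hdim ?_
  rintro _ ⟨w, rfl⟩ hw0
  rw [hr, ← norm_toL2_hatSection_sq h h' _ (hker w), ← norm_sq_eq_of_fst_eq_zero _ (hker w)]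
  refine hlt _ w.1.2 fun h0 => hw0 ?_
  rw [hr, h0]; rfl

theorem encard_le_subtype_add_one {ι : Type*} (P : ι → Prop) (i₀ : ι) :
    {i | P i}.encard ≤ {i : {i // i ≠ i₀} | P i}.encard + 1 := by
  have h1 : {i | P i} ⊆ insert i₀ (Subtype.val '' {i : {i // i ≠ i₀} | P i}) := fun i hi => by
    by_cases h : i = i₀
    · exact Or.inl h
    · exact Or.inr ⟨⟨i, h⟩, hi, rfl⟩
  refine (Set.encard_le_encard h1).trans ((Set.encard_insert_le _ _).trans ?_)
  rw [Subtype.val_injective.encard_image]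

theorem subtype_add_one_le_encard {ι : Type*} {P : ι → Prop} {i₀ : ι} (h : P i₀) :
    {i : {i // i ≠ i₀} | P i}.encard + 1 ≤ {i | P i}.encard := by
  rw [← Subtype.val_injective.encard_image, ← Set.encard_insert_of_notMem (a := i₀)]
  · refine Set.encard_le_encard ?_
    rintro i (rfl | ⟨k, hk, rfl⟩)
    exacts [h, hk]
  · rintro ⟨k, _, hk⟩
    exact k.2 hk

/-- All eigenvalues of `K` but the largest, multiplied by `a²`, are dominated by the weights of
`1 - a² + a² K` but the largest. -/
theorem encard_eigenvalue_le (h : IsFeatureMap μ (kernelSection H (X := X)))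
    {h' : IsFeatureMap μ (hatSection H (X := X) a)} (hb : Diagonalizes b h'.toL2) (i₀ : ι)
    {θ : ℝ} (hθ : 0 < θ) :
    {j : ℕ | θ < a ^ 2 * eigenvalue H μ (j + 1)}.encard
      ≤ {i : {i // i ≠ i₀} | θ < ‖h'.toL2 (b i)‖ ^ 2}.encard := by
  refine ENat.forall_natCast_le_iff_le.1 fun k hk => ?_
  rcases k with _ | k
  · simp
  obtain ⟨j, hj, hkj⟩ : ∃ j, θ < a ^ 2 * eigenvalue H μ (j + 1) ∧ k ≤ j := by
    by_contra! hcon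
    have h1 : {j : ℕ | θ < a ^ 2 * eigenvalue H μ (j + 1)} ⊆ (Finset.range k : Set ℕ) :=
      fun j hj => by simpa using hcon j hj
    have h2 := hk.trans (Set.encard_le_encard h1)
    rw [Set.encard_coe_eq_coe_finsetCard, Finset.card_range, Nat.cast_le] at h2
    omega
  have h1 := (le_encard_of_lt_eigenvalue h hb hθ hj).trans (encard_le_subtype_add_one _ i₀)
  have h2 : ((k + 1 : ℕ) : ℕ∞) + 1 ≤ ((j + 1 + 1 : ℕ) : ℕ∞) := by exact_mod_cast by omega
  exact (ENat.add_le_add_iff_right (by simp)).1 (h2.trans h1)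

/-- The weights of `1 - a² + a² K` but the largest are dominated by all eigenvalues of `K` but the
largest, multiplied by `a²`, together with one more number `κ` that bounds the trace defect. -/
theorem encard_le_eigenvalue (h : IsFeatureMap μ (kernelSection H (X := X)))
    {h' : IsFeatureMap μ (hatSection H (X := X) a)} (hb : Diagonalizes b h'.toL2) {i₀ : ι}
    (hi₀ : ∀ i, ‖h'.toL2 (b i)‖ ^ 2 ≤ ‖h'.toL2 (b i₀)‖ ^ 2) {κ : ℝ}
    (hκ : ∀ i, i ≠ i₀ → ‖h'.toL2 (b i)‖ ^ 2 ≤ κ) {θ : ℝ} :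
    {i : {i // i ≠ i₀} | θ < ‖h'.toL2 (b i)‖ ^ 2}.encard
      ≤ {o : Option ℕ | θ < o.elim κ fun j => a ^ 2 * eigenvalue H μ (j + 1)}.encard := by
  refine ENat.forall_natCast_le_iff_le.1 fun k hk => ?_
  rcases k with _ | k
  · simp
  obtain ⟨e, he⟩ := exists_embedding_of_le_encard hk
  have h0 : θ < ‖h'.toL2 (b i₀)‖ ^ 2 := (he 0).trans_le (hi₀ _)
  have h1 : ((k + 2 : ℕ) : ℕ∞) ≤ {i | θ < ‖h'.toL2 (b i)‖ ^ 2}.encard :=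
    le_trans (by push_cast; rw [← one_add_one_eq_two, ← add_assoc]; gcongr; exact_mod_cast hk)
      (subtype_add_one_le_encard (P := fun i => θ < ‖h'.toL2 (b i)‖ ^ 2) h0)
  have h2 : ((Finset.insertNone (Finset.range k) : Finset (Option ℕ)) : Set (Option ℕ))
      ⊆ {o : Option ℕ | θ < o.elim κ fun j => a ^ 2 * eigenvalue H μ (j + 1)} := by
    intro o ho
    rcases o with _ | j
    · exact (he 0).trans_le (hκ _ (e 0).2)
    · have hj : j < k := by simpa using ho
      refine lt_eigenvalue_of_le_encard h hb (j := j + 1) (le_trans ?_ h1)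
      exact_mod_cast by omega
  refine le_trans (le_of_eq ?_) (Set.encard_le_encard h2)
  rw [Set.encard_coe_eq_coe_finsetCard, Finset.card_insertNone, Finset.card_range]

end Hat

/-! ### Sums of powers from counting functions -/

section LayerCake

/-- The layer cake formula for the counting measure. -/
theorem tsum_rpow_eq_lintegral_encard {ι : Type*} {f : ι → ℝ} (hf : ∀ i, 0 ≤ f i) {p : ℝ}
    (hp : 0 < p) :
    ∑' i, ENNReal.ofReal (f i ^ p) = ENNReal.ofReal p *
      ∫⁻ t in Set.Ioi (0 : ℝ), ({i | t < f i}.encard : ℝ≥0∞) * ENNReal.ofReal (t ^ (p - 1)) := by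
  let _ : MeasurableSpace ι := ⊤
  have h := lintegral_rpow_eq_lintegral_meas_lt_mul (Measure.count : Measure ι) (f := f)
    (ae_of_all _ hf) (Measurable.aemeasurable fun _ _ => trivial) hp
  rw [lintegral_count] at h
  rw [h]
  simp only [Measure.count_apply MeasurableSpace.measurableSet_top]

theorem tsum_rpow_le_of_encard_le {ι κ : Type*} {f : ι → ℝ} {g : κ → ℝ} (hf : ∀ i, 0 ≤ f i)
    (hg : ∀ i, 0 ≤ g i) {p : ℝ} (hp : 0 < p)
    (h : ∀ t, 0 < t → {i | t < f i}.encard ≤ {k | t < g k}.encard) :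
    ∑' i, ENNReal.ofReal (f i ^ p) ≤ ∑' k, ENNReal.ofReal (g k ^ p) := by
  rw [tsum_rpow_eq_lintegral_encard hf hp, tsum_rpow_eq_lintegral_encard hg hp]
  gcongr ENNReal.ofReal p * ?_
  refine setLIntegral_mono' measurableSet_Ioi fun t ht => ?_
  gcongr
  exact h t ht

/-- A bound of weak type for the counting function bounds all larger powers; the right-hand side is
finite for `s < p` and does not depend on `f`. -/
theorem tsum_rpow_le_of_encard_le_rpow {ι : Type*} {f : ι → ℝ} (hf : ∀ i, 0 ≤ f i)
    (hf1 : ∀ i, f i ≤ 1) {p s C : ℝ} (hp : 0 < p)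
    (h : ∀ t, 0 < t → t < 1 → ({i | t < f i}.encard : ℝ≥0∞) ≤ ENNReal.ofReal (C * t ^ (-s))) :
    ∑' i, ENNReal.ofReal (f i ^ p) ≤ ENNReal.ofReal p *
      ∫⁻ t in Set.Ioo (0 : ℝ) 1, ENNReal.ofReal (C * t ^ (p - s - 1)) := by
  rw [tsum_rpow_eq_lintegral_encard hf hp]
  gcongr ENNReal.ofReal p * ?_
  rw [← lintegral_indicator measurableSet_Ioi, ← lintegral_indicator measurableSet_Ioo]
  refine lintegral_mono fun t => ?_
  by_cases ht0 : 0 < t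
  · rw [Set.indicator_of_mem (Set.mem_Ioi.2 ht0)]
    by_cases ht1 : t < 1
    · rw [Set.indicator_of_mem (Set.mem_Ioo.2 ⟨ht0, ht1⟩)]
      refine (mul_le_mul_left (h t ht0 ht1) _).trans (le_of_eq ?_)
      rw [← ENNReal.ofReal_mul' (by positivity), mul_assoc, ← Real.rpow_add ht0]
      congr 3
      ring
    · have : {i | t < f i} = ∅ := by
        ext i
        simpa using (hf1 i).trans (not_lt.1 ht1)
      simp [this]
  · rw [Set.indicator_of_notMem (by simpa using ht0)]
    exact zero_le

theorem lintegral_Ioo_rpow_ne_top {C q : ℝ} (hq : 0 < q) :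
    ∫⁻ t in Set.Ioo (0 : ℝ) 1, ENNReal.ofReal (C * t ^ (q - 1)) ≠ ⊤ := by
  have h1 : IntegrableOn (fun t : ℝ => C * t ^ (q - 1)) (Set.Ioo 0 1) := by
    have h2 := (intervalIntegral.intervalIntegrable_rpow' (a := 0) (b := 1)
      (r := q - 1) (by linarith)).1.const_mul C
    exact IntegrableOn.mono_set h2 Set.Ioo_subset_Ioc_self
  exact ne_of_lt (lt_of_le_of_lt (lintegral_mono fun t => ENNReal.ofReal_le_ofReal (le_abs_self _))
    (by simpa [HasFiniteIntegral, Real.enorm_eq_ofReal_abs] using h1.2))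

end LayerCake

/-! ### Tensor products of feature maps -/

section Product

theorem tsum_pi_prod : ∀ {d : ℕ} {ι : Fin d → Type u} (f : ∀ l, ι l → ℝ≥0∞),
    ∑' i : ∀ l, ι l, ∏ l, f l (i l) = ∏ l, ∑' k, f l k
  | 0, ι, f => by
    rw [tsum_eq_single default fun i hi => absurd (Subsingleton.elim i default) hi]
    simp
  | d + 1, ι, f => by
    rw [← (Fin.consEquiv ι).tsum_eq, ENNReal.tsum_prod', Fin.prod_univ_succ,
      ← tsum_pi_prod fun l => f l.succ, ← ENNReal.tsum_mul_right]
    refine tsum_congr fun k => ?_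
    rw [← ENNReal.tsum_mul_left]
    refine tsum_congr fun i => ?_
    rw [Fin.prod_univ_succ]
    simp [Fin.consEquiv]

theorem hasSum_pi_prod {d : ℕ} {ι : Fin d → Type u} {f : ∀ l, ι l → ℝ} {s : Fin d → ℝ}
    (h : ∀ l, HasSum (f l) (s l)) :
    HasSum (fun i : ∀ l, ι l => ∏ l, f l (i l)) (∏ l, s l) := by
  induction d with
  | zero =>
    have h := hasSum_unique fun i : ∀ l, ι l => ∏ l, f l (i l)
    simp only [Finset.univ_eq_empty, Finset.prod_empty] at h ⊢
    exact h
  | succ d ih =>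
    have h1 := ih fun l : Fin d => h l.succ
    have hs : Summable fun z : ι 0 × (∀ l : Fin d, ι l.succ) =>
        f 0 z.1 * ∏ l : Fin d, f l.succ (z.2 l) :=
      summable_mul_of_summable_norm (f := f 0)
        (g := fun i : ∀ l : Fin d, ι l.succ => ∏ l : Fin d, f l.succ (i l))
        (h 0).summable.norm h1.summable.norm
    have h2 := (h 0).mul h1 hs
    rw [← (Fin.consEquiv ι).hasSum_iff, Fin.prod_univ_succ]
    have h3 : ((fun i : ∀ l, ι l => ∏ l, f l (i l)) ∘ Fin.consEquiv ι)
        = fun z : ι 0 × (∀ l : Fin d, ι l.succ) => f 0 z.1 * ∏ l : Fin d, f l.succ (z.2 l) := by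
      ext z
      simp [Fin.prod_univ_succ, Fin.consEquiv]
    rw [h3]
    exact h2

variable {d : ℕ} {Y : Type*} {ι : Fin d → Type u} {E : Fin d → Type*}
  [∀ l, NormedAddCommGroup (E l)] [∀ l, InnerProductSpace ℝ (E l)]

theorem hasSum_prod_inner (b : ∀ l, HilbertBasis (ι l) ℝ (E l)) (Φ : ∀ l, Y → E l)
    (x t : Fin d → Y) :
    HasSum (fun i : ∀ l, ι l => (∏ l, inner ℝ (b l (i l)) (Φ l (x l))) *
      ∏ l, inner ℝ (b l (i l)) (Φ l (t l))) (∏ l, inner ℝ (Φ l (x l)) (Φ l (t l))) := by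
  simp only [← Finset.prod_mul_distrib]
  refine hasSum_pi_prod (f := fun l k => inner ℝ (b l k) (Φ l (x l)) * inner ℝ (b l k) (Φ l (t l)))
    fun l => ?_
  simpa only [real_inner_comm] using (b l).hasSum_inner_mul_inner (Φ l (x l)) (Φ l (t l))

/-- The tensor product of the feature maps `Φ l`, written in the coordinates given by the
Hilbert bases `b l`. -/
def prodSection (b : ∀ l, HilbertBasis (ι l) ℝ (E l)) (Φ : ∀ l, Y → E l) (x : Fin d → Y) :
    lp (fun _ : ∀ l, ι l => ℝ) 2 :=
  ⟨fun i => ∏ l, inner ℝ (b l (i l)) (Φ l (x l)), memℓp_gen (by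
    have := (hasSum_prod_inner b Φ x x).summable
    simpa only [ENNReal.toReal_ofNat, Real.rpow_two, Real.norm_eq_abs, sq,
      abs_mul_abs_self] using this)⟩

theorem inner_prodSection (b : ∀ l, HilbertBasis (ι l) ℝ (E l)) (Φ : ∀ l, Y → E l)
    (x t : Fin d → Y) : inner ℝ (prodSection b Φ x) (prodSection b Φ t)
      = ∏ l, inner ℝ (Φ l (x l)) (Φ l (t l)) := by
  refine (lp.hasSum_inner _ _).unique ?_
  simpa [prodSection, mul_comm] using hasSum_prod_inner b Φ x t

/-- The standard Hilbert basis of `ℓ²`. -/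
def stdBasis (κ : Type*) : HilbertBasis κ ℝ (lp (fun _ : κ => ℝ) 2) :=
  HilbertBasis.ofRepr (LinearIsometryEquiv.refl ℝ _)

theorem inner_stdBasis {κ : Type*} (i : κ) (v : lp (fun _ : κ => ℝ) 2) :
    inner ℝ (stdBasis κ i) v = v i := by
  rw [← HilbertBasis.repr_apply_apply]; rfl

variable [MeasurableSpace Y] {μ : Fin d → Measure Y} [∀ l, SigmaFinite (μ l)]

theorem isFeatureMap_prodSection (b : ∀ l, HilbertBasis (ι l) ℝ (E l)) {Φ : ∀ l, Y → E l}
    (h : ∀ l, IsFeatureMap (μ l) (Φ l)) : IsFeatureMap (Measure.pi μ) (prodSection b Φ) where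
  measurable_inner := measurable_inner_of_dense (stdBasis _).dense_span (by
    rintro _ ⟨i, rfl⟩
    simp only [inner_stdBasis]
    exact Finset.measurable_prod Finset.univ fun l _ =>
      ((h l).measurable_inner (b l (i l))).comp (measurable_pi_apply l))
  integrable_norm_sq := by
    simp only [← real_inner_self_eq_norm_sq, inner_prodSection]
    refine Integrable.fintype_prod (f := fun l y => inner ℝ (Φ l y) (Φ l y)) fun l => ?_
    simpa only [real_inner_self_eq_norm_sq] using (h l).integrable_norm_sq

theorem inner_toL2_prodSection {b : ∀ l, HilbertBasis (ι l) ℝ (E l)} {Φ : ∀ l, Y → E l}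
    (h : ∀ l, IsFeatureMap (μ l) (Φ l)) (i k : ∀ l, ι l) :
    inner ℝ ((isFeatureMap_prodSection b h).toL2 (stdBasis _ i))
        ((isFeatureMap_prodSection b h).toL2 (stdBasis _ k))
      = ∏ l, inner ℝ ((h l).toL2 (b l (i l))) ((h l).toL2 (b l (k l))) := by
  rw [IsFeatureMap.inner_toL2]
  simp only [inner_stdBasis, IsFeatureMap.inner_toL2]
  rw [← integral_fintype_prod_eq_prod]
  simp only [prodSection, Finset.prod_mul_distrib]

theorem norm_toL2_prodSection_sq {b : ∀ l, HilbertBasis (ι l) ℝ (E l)} {Φ : ∀ l, Y → E l}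
    (h : ∀ l, IsFeatureMap (μ l) (Φ l)) (i : ∀ l, ι l) :
    ‖(isFeatureMap_prodSection b h).toL2 (stdBasis _ i)‖ ^ 2
      = ∏ l, ‖(h l).toL2 (b l (i l))‖ ^ 2 := by
  simp only [← real_inner_self_eq_norm_sq, inner_toL2_prodSection h]

/-- Tensor products of eigenfunctions are eigenfunctions, with the products of the eigenvalues. -/
theorem diagonalizes_prodSection {b : ∀ l, HilbertBasis (ι l) ℝ (E l)} {Φ : ∀ l, Y → E l}
    (h : ∀ l, IsFeatureMap (μ l) (Φ l)) (hb : ∀ l, Diagonalizes (b l) (h l).toL2) :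
    Diagonalizes (stdBasis _) (isFeatureMap_prodSection b h).toL2 := by
  refine diagonalizes_of_pairwise fun i k hik => ?_
  obtain ⟨l, hl⟩ := Function.ne_iff.1 hik
  rw [inner_toL2_prodSection h]
  refine Finset.prod_eq_zero (Finset.mem_univ l) ?_
  rw [hb l, (b l).orthonormal.2 hl, mul_zero]

end Product

/-! ### Minimal errors and sums of powers of the weights -/

section Rates

variable {X : Type*} [MeasurableSpace X] {μ : Measure X} (H : Type*) [NormedAddCommGroup H]
  [InnerProductSpace ℝ H] [RKHS ℝ H X ℝ] [CompleteSpace H] {E ι : Type*} [NormedAddCommGroup E]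
  [InnerProductSpace ℝ E] [CompleteSpace E] {Φ : X → E} {b : HilbertBasis ι ℝ E} {i₀ : ι}

theorem embeddingNorm_eq (hΦ : IsFeatureMap μ Φ)
    (hK : ∀ x t, inner ℝ (Φ x) (Φ t) = reproducingKernel H x t) (hb : Diagonalizes b hΦ.toL2)
    (hi₀ : ∀ i, ‖hΦ.toL2 (b i)‖ ^ 2 ≤ ‖hΦ.toL2 (b i₀)‖ ^ 2) :
    embeddingNorm H μ = ENNReal.ofReal √(‖hΦ.toL2 (b i₀)‖ ^ 2) := by
  rw [← minimalError_zero]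
  refine le_antisymm ?_ ?_
  · exact minimalError_card_le H hΦ hK hb (A := ∅) (sq_nonneg _) fun i _ => hi₀ i
  · exact le_minimalError H hΦ hK hb (A := {i₀}) (by simp) (by simp)

/-- A bound `M` for the sum of the `τ`-th powers of the normalized weights gives the rate
`n ^ (-1 / (2 τ))` for the minimal errors, relative to the norm of the embedding. -/
theorem minimalError_le_of_tsum_rpow_le (hΦ : IsFeatureMap μ Φ)
    (hK : ∀ x t, inner ℝ (Φ x) (Φ t) = reproducingKernel H x t) (hb : Diagonalizes b hΦ.toL2)
    (hi₀ : ∀ i, ‖hΦ.toL2 (b i)‖ ^ 2 ≤ ‖hΦ.toL2 (b i₀)‖ ^ 2) (hpos : 0 < ‖hΦ.toL2 (b i₀)‖ ^ 2)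
    {τ M : ℝ} (hτ : 0 < τ) (hM : 0 ≤ M)
    (hsum : ∑' i, ENNReal.ofReal ((‖hΦ.toL2 (b i)‖ ^ 2 / ‖hΦ.toL2 (b i₀)‖ ^ 2) ^ τ)
      ≤ ENNReal.ofReal M) {n : ℕ} (hn : 1 ≤ n) :
    minimalError H μ n ≤ embeddingNorm H μ * ENNReal.ofReal ((M / n) ^ (1 / (2 * τ))) := by
  rw [embeddingNorm_eq H hΦ hK hb hi₀]
  set W := ‖hΦ.toL2 (b i₀)‖ ^ 2 with hW
  have hn0 : (0 : ℝ) < n := by exact_mod_cast hn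
  have hMn : 0 ≤ M / n := by positivity
  set θ := W * (M / n) ^ (1 / τ) with hθ
  have hθ0 : 0 ≤ θ := by positivity
  -- By Markov's inequality, at most `n` weights exceed `θ`.
  have hcount : {i | θ < ‖hΦ.toL2 (b i)‖ ^ 2}.encard ≤ n := by
    by_contra! hlt
    obtain ⟨e, he⟩ := exists_embedding_of_le_encard (n := n + 1)
      (by exact_mod_cast Order.add_one_le_of_lt hlt)
    have h1 : ∀ k, M / n < (‖hΦ.toL2 (b (e k))‖ ^ 2 / W) ^ τ := fun k => by
      have h2 : (M / n) ^ (1 / τ) < ‖hΦ.toL2 (b (e k))‖ ^ 2 / W := by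
        rw [lt_div_iff₀' hpos]; exact he k
      calc M / n = ((M / n) ^ (1 / τ)) ^ τ := by
            rw [← Real.rpow_mul hMn, one_div_mul_cancel hτ.ne', Real.rpow_one]
        _ < _ := Real.rpow_lt_rpow (by positivity) h2 hτ
    have h3 : ENNReal.ofReal (∑ k, (‖hΦ.toL2 (b (e k))‖ ^ 2 / W) ^ τ) ≤ ENNReal.ofReal M := by
      rw [ENNReal.ofReal_sum_of_nonneg fun k _ => by positivity]
      refine le_trans ?_ hsum
      refine le_trans (le_of_eq ?_) (ENNReal.sum_le_tsum (Finset.univ.map e))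
      rw [Finset.sum_map]
    rw [ENNReal.ofReal_le_ofReal_iff hM] at h3
    have h4 : ∑ _k : Fin (n + 1), M / n < ∑ k, (‖hΦ.toL2 (b (e k))‖ ^ 2 / W) ^ τ :=
      Finset.sum_lt_sum_of_nonempty Finset.univ_nonempty fun k _ => h1 k
    rw [Finset.sum_const, Finset.card_univ, Fintype.card_fin, nsmul_eq_mul] at h4
    have h5 : ((n + 1 : ℕ) : ℝ) * (M / n) = M + M / n := by
      push_cast; field_simp
    linarith
  have hfin : {i | θ < ‖hΦ.toL2 (b i)‖ ^ 2}.Finite := Set.finite_of_encard_le_coe hcount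
  rw [hfin.encard_eq_coe_toFinset_card, Nat.cast_le] at hcount
  refine (minimalError_antitone H hcount).trans ((minimalError_card_le H hΦ hK hb hθ0
    fun i hi => by simpa using hi).trans (le_of_eq ?_))
  rw [← ENNReal.ofReal_mul (Real.sqrt_nonneg _), hθ, Real.sqrt_mul hpos.le]
  congr 2
  rw [Real.sqrt_eq_rpow, ← Real.rpow_mul hMn]
  congr 1
  field_simp

/-- If `n` functionals achieve the normalized error `ε`, then at most `n` normalized weights exceed
`ε ^ 2`. -/
theorem encard_le_of_minimalError_le (hΦ : IsFeatureMap μ Φ)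
    (hK : ∀ x t, inner ℝ (Φ x) (Φ t) = reproducingKernel H x t) (hb : Diagonalizes b hΦ.toL2)
    (hi₀ : ∀ i, ‖hΦ.toL2 (b i)‖ ^ 2 ≤ ‖hΦ.toL2 (b i₀)‖ ^ 2) (hpos : 0 < ‖hΦ.toL2 (b i₀)‖ ^ 2)
    {ε : ℝ} (hε : 0 < ε) {n : ℕ}
    (hn : minimalError H μ n ≤ ENNReal.ofReal ε * embeddingNorm H μ) :
    {i | ε ^ 2 < ‖hΦ.toL2 (b i)‖ ^ 2 / ‖hΦ.toL2 (b i₀)‖ ^ 2}.encard ≤ n := by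
  rw [embeddingNorm_eq H hΦ hK hb hi₀] at hn
  set W := ‖hΦ.toL2 (b i₀)‖ ^ 2 with hW
  by_contra! hlt
  obtain ⟨e, he⟩ := exists_embedding_of_le_encard (n := n + 1)
    (by exact_mod_cast Order.add_one_le_of_lt hlt)
  obtain ⟨k, hk⟩ := Finite.exists_min fun k => ‖hΦ.toL2 (b (e k))‖ ^ 2
  have h1 := le_minimalError H hΦ hK hb (A := Finset.univ.map e)
    (θ := ‖hΦ.toL2 (b (e k))‖ ^ 2) (n := n) (by simpa using hk) (by simp)
  have h2 := h1.trans hn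
  rw [← ENNReal.ofReal_mul hε.le, ENNReal.ofReal_le_ofReal_iff (by positivity)] at h2
  have h3 := (lt_div_iff₀ hpos).1 (he k)
  have h4 : √(‖hΦ.toL2 (b (e k))‖ ^ 2) ^ 2 ≤ (ε * √W) ^ 2 := by gcongr
  rw [Real.sq_sqrt (sq_nonneg _), mul_pow, Real.sq_sqrt hpos.le] at h4
  linarith

end Rates

/-! ### The univariate weights -/

section Univariate

variable {X : Type*} [MeasurableSpace X] {μ : Measure X} {H : Type u} [NormedAddCommGroup H]
  [InnerProductSpace ℝ H] [RKHS ℝ H X ℝ] [CompleteSpace H] {a : ℝ}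

theorem eigenvalue_nonneg (h : IsFeatureMap μ (kernelSection H (X := X))) (j : ℕ) :
    0 ≤ eigenvalue H μ j := by
  rw [eigenvalue]
  rcases Set.eq_empty_or_nonempty {c : ℝ | ∃ η : Fin (j + 1) → H, Orthonormal ℝ η ∧
    ∀ i, ∃ b : ℝ, c ≤ b ∧ IsEigenpair H μ b (η i)} with h0 | ⟨c, η, hη, hη'⟩
  · rw [h0, Real.sSup_empty]
  · refine Real.sSup_nonneg' ⟨0, ⟨η, hη, fun i => ?_⟩, le_rfl⟩
    obtain ⟨β, -, hβ⟩ := hη' i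
    refine ⟨β, ?_, hβ⟩
    have h2 := hβ.inner_toL2 h (η i)
    rw [real_inner_self_eq_norm_sq, real_inner_self_eq_norm_sq, hη.1 i, one_pow, mul_one] at h2
    rw [← h2]
    positivity

theorem exists_forall_le_of_summable {ι : Type*} [Nonempty ι] {f : ι → ℝ} (hf : ∀ i, 0 ≤ f i)
    (hs : Summable f) : ∃ i₀, ∀ i, f i ≤ f i₀ := by
  by_cases h0 : ∀ i, f i ≤ 0
  · exact ⟨Classical.arbitrary ι, fun i => (h0 i).trans (hf _)⟩
  · push Not at h0
    obtain ⟨i₁, hi₁⟩ := h0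
    have hfin : {i | ¬ f i < f i₁}.Finite :=
      hs.tendsto_cofinite_zero.eventually (gt_mem_nhds hi₁)
    obtain ⟨i₀, hi₀, hmax⟩ := Set.exists_max_image _ f hfin ⟨i₁, lt_irrefl _⟩
    refine ⟨i₀, fun i => ?_⟩
    by_cases hi : f i < f i₁
    · exact hi.le.trans (hmax i₁ (lt_irrefl _))
    · exact hmax i hi

theorem tsum_option_ennreal {ι : Type*} (f : Option ι → ℝ≥0∞) :
    ∑' o, f o = f none + ∑' i, f (some i) := by
  rw [← (Equiv.optionEquivSumPUnit.{0} ι).symm.tsum_eq,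
    Summable.tsum_sum ENNReal.summable ENNReal.summable, add_comm]
  simp

theorem tsum_eq_add_tsum_ne {ι : Type*} (f : ι → ℝ≥0∞) (i₀ : ι) :
    ∑' i, f i = f i₀ + ∑' i : {i // i ≠ i₀}, f i := by
  classical
  rw [← (Equiv.optionSubtypeNe i₀).tsum_eq, tsum_option_ennreal]
  simp

/-- The weights of `1 - a² + a² K`, if the trace of `K` is at most `1` and its integral is at least
`1 - D`. There is a largest weight, close to `1`, and the sums of powers of the others are
comparable to those of the eigenvalues of `K` but the largest, multiplied by `a²`. -/
theorem exists_hat_weights [IsProbabilityMeasure μ] (ha : 0 ≤ a ∧ a ≤ 1)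
    (h : IsFeatureMap μ (kernelSection H (X := X)))
    (hm : Measurable fun z : X × X => reproducingKernel H z.1 z.2)
    (htr : ∫ x, reproducingKernel H x x ∂μ = 1) {D : ℝ}
    (hD : 1 - D ≤ ∫ z : X × X, reproducingKernel H z.1 z.2 ∂(μ.prod μ))
    (heig : ∃ j, 0 < eigenvalue H μ j) (h' : IsFeatureMap μ (hatSection H (X := X) a)) :
    ∃ (ι : Type u) (b : HilbertBasis ι ℝ (WithLp 2 (ℝ × H))) (i₀ : ι),
      Diagonalizes b h'.toL2 ∧ (∀ i, ‖h'.toL2 (b i)‖ ^ 2 ≤ ‖h'.toL2 (b i₀)‖ ^ 2) ∧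
      0 < ‖h'.toL2 (b i₀)‖ ^ 2 ∧ ‖h'.toL2 (b i₀)‖ ^ 2 ≤ 1 ∧
      1 - a ^ 2 * D ≤ ‖h'.toL2 (b i₀)‖ ^ 2 ∧
      (∀ j, a ^ 2 * eigenvalue H μ (j + 1) ≤ a ^ 2 * D) ∧
      ∀ τ : ℝ, 0 < τ →
        ∑' j, ENNReal.ofReal ((a ^ 2 * eigenvalue H μ (j + 1)) ^ τ)
          ≤ ∑' i : {i // i ≠ i₀}, ENNReal.ofReal ((‖h'.toL2 (b i)‖ ^ 2) ^ τ) ∧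
        ∑' i : {i // i ≠ i₀}, ENNReal.ofReal ((‖h'.toL2 (b i)‖ ^ 2) ^ τ)
          ≤ ENNReal.ofReal ((a ^ 2 * D) ^ τ)
            + ∑' j, ENNReal.ofReal ((a ^ 2 * eigenvalue H μ (j + 1)) ^ τ) := by
  obtain ⟨ι, b, hb⟩ := exists_diagonalizes h'.isCompactOperator_toL2
  have hne : Nonempty ι := by
    by_contra hemp
    rw [not_nonempty_iff] at hemp
    have h1 := (hasSum_inner_sq b (WithLp.toLp 2 ((1 : ℝ), (0 : H)))).unique hasSum_empty
    simp at h1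
  obtain ⟨i₀, hi₀⟩ := exists_forall_le_of_summable (fun _ => sq_nonneg _)
    (h'.summable_norm_toL2_sq b.orthonormal)
  have hi := h.integrable_norm_sq
  simp only [← real_inner_self_eq_norm_sq, inner_kernelSection_kernelSection] at hi
  have htr' : ∫ x, ‖hatSection H a x‖ ^ 2 ∂μ = 1 := by
    simp only [← real_inner_self_eq_norm_sq, inner_hatSection_hatSection ha]
    rw [integral_add (integrable_const _) (hi.const_mul _), integral_const_mul, htr]
    simp
  have hle1 : ‖h'.toL2 (b i₀)‖ ^ 2 ≤ 1 := by
    have := h'.sum_norm_toL2_sq_le b.orthonormal {i₀}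
    rwa [Finset.sum_singleton, htr'] at this
  have hge : 1 - a ^ 2 * D ≤ ‖h'.toL2 (b i₀)‖ ^ 2 := by
    have h1 := h'.integral_inner_le (sq_nonneg ‖h'.toL2 (b i₀)‖)
      (fun v => hb.norm_sq_le fun i _ => hi₀ i) (by
        simp only [inner_hatSection_hatSection ha]
        exact (hm.const_mul _).const_add _)
    simp only [inner_hatSection_hatSection ha] at h1
    have hint : Integrable (fun z : X × X => reproducingKernel H z.1 z.2) (μ.prod μ) := by
      simpa only [inner_kernelSection_kernelSection] using
        h.integrable_inner (by simpa only [inner_kernelSection_kernelSection] using hm)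
    rw [integral_add (integrable_const _) (hint.const_mul _), integral_const_mul] at h1
    simp only [integral_const, probReal_univ, one_smul] at h1
    nlinarith [sq_nonneg a]
  have hκ : ∀ i, i ≠ i₀ → ‖h'.toL2 (b i)‖ ^ 2 ≤ a ^ 2 * D := fun i hi => by
    classical
    have := h'.sum_norm_toL2_sq_le b.orthonormal {i, i₀}
    rw [Finset.sum_pair hi, htr'] at this
    linarith
  have hκ0 : 0 ≤ a ^ 2 * D := by linarith
  have hpos : 0 < ‖h'.toL2 (b i₀)‖ ^ 2 := by
    by_cases ha0 : a = 0
    · have h0 : a ^ 2 * D = 0 := by rw [ha0]; ring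
      linarith
    · obtain ⟨j, hj⟩ := heig
      have ha2 : 0 < a ^ 2 := by positivity
      have h1 : 0 < a ^ 2 * eigenvalue H μ j := by positivity
      have h2 := le_encard_of_lt_eigenvalue h hb (half_pos h1) (half_lt_self h1)
      obtain ⟨e, he⟩ := exists_embedding_of_le_encard h2
      exact (half_pos h1).trans ((he 0).trans_le (hi₀ _))
  have hle : ∀ j, a ^ 2 * eigenvalue H μ (j + 1) ≤ a ^ 2 * D := fun j => by
    by_contra! hlt
    obtain ⟨θ, hθ1, hθ2⟩ := exists_between hlt
    have h1 := encard_eigenvalue_le h hb i₀ (hκ0.trans_lt hθ1)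
    have h2 : {i : {i // i ≠ i₀} | θ < ‖h'.toL2 (b i)‖ ^ 2} = ∅ := by
      ext i
      simpa using (hκ i i.2).trans hθ1.le
    rw [h2, Set.encard_empty, nonpos_iff_eq_zero, Set.encard_eq_zero] at h1
    exact Set.notMem_empty j (h1 ▸ hθ2)
  have heig0 : ∀ j, 0 ≤ a ^ 2 * eigenvalue H μ j := fun j =>
    mul_nonneg (sq_nonneg _) (eigenvalue_nonneg h j)
  refine ⟨ι, b, i₀, hb, hi₀, hpos, hle1, hge, hle, fun τ hτ => ⟨?_, ?_⟩⟩
  · exact tsum_rpow_le_of_encard_le (fun j => heig0 (j + 1)) (fun i => sq_nonneg _) hτ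
      fun θ hθ => encard_eigenvalue_le h hb i₀ hθ
  · have h1 := tsum_rpow_le_of_encard_le (f := fun i : {i // i ≠ i₀} => ‖h'.toL2 (b i)‖ ^ 2)
      (g := fun o : Option ℕ => o.elim (a ^ 2 * D) fun j => a ^ 2 * eigenvalue H μ (j + 1))
      (fun i => sq_nonneg _) (by rintro (_ | j); exacts [hκ0, heig0 (j + 1)]) hτ
      fun θ _ => encard_le_eigenvalue h hb hi₀ hκ
    rw [tsum_option_ennreal] at h1
    exact h1

end Univariate

/-! ### The decay rate and the sums over the eigenvalues -/

section Decay

theorem summable_rpow_of_lt_decayRate {α γ : ℕ → ℝ} (h0 : ∀ l, 0 ≤ α l * γ l) {t : ℝ}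
    (ht0 : 0 < t) (ht : ENNReal.ofReal t < decayRate α γ) :
    Tendsto (fun l => α l * γ l) atTop (𝓝 0) ∧ Summable fun l => (α l * γ l) ^ (1 / t) := by
  simp only [decayRate, lt_iSup_iff] at ht
  obtain ⟨β, hβ0, hs, hβ⟩ := ht
  rw [ENNReal.ofReal_lt_ofReal_iff hβ0] at hβ
  have hlim : Tendsto (fun l => α l * γ l) atTop (𝓝 0) := by
    have h1 := hs.tendsto_atTop_zero.rpow_const (p := β) (Or.inr hβ0.le)
    rw [Real.zero_rpow hβ0.ne'] at h1
    refine h1.congr fun l => ?_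
    rw [← Real.rpow_mul (h0 l), one_div_mul_cancel hβ0.ne', Real.rpow_one]
  refine ⟨hlim, hs.of_norm_bounded_eventually_nat ?_⟩
  filter_upwards [hlim.eventually (gt_mem_nhds one_pos)] with l hl
  rw [Real.norm_of_nonneg (Real.rpow_nonneg (h0 l) _)]
  exact Real.rpow_le_rpow_of_exponent_ge_of_imp (h0 l) hl.le
    (one_div_le_one_div_of_le ht0 hβ.le) fun _ h => absurd h (by positivity)

theorem ofReal_le_decayRate {α γ : ℕ → ℝ} {t : ℝ} (ht0 : 0 < t)
    (hs : Summable fun l => (α l * γ l) ^ (1 / t)) : ENNReal.ofReal t ≤ decayRate α γ :=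
  le_iSup_of_le t (le_iSup₂_of_le ht0 hs le_rfl)

theorem exists_pos_forall_le {f : ℕ → ℝ} (hf : ∀ l, 0 < f l) {c : ℝ} (hc : 0 < c)
    (h : ∀ᶠ l in atTop, c ≤ f l) : ∃ c', 0 < c' ∧ ∀ l, c' ≤ f l := by
  obtain ⟨N, hN⟩ := eventually_atTop.1 h
  obtain ⟨k, hk⟩ := Finite.exists_min fun k : Fin (N + 1) => f k
  refine ⟨min c (f k), lt_min hc (hf k), fun l => ?_⟩
  rcases le_total N l with hl | hl
  · exact (min_le_left _ _).trans (hN l hl)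
  · exact (min_le_right _ _).trans (hk ⟨l, Nat.lt_succ_of_le hl⟩)

variable {e : ℕ → ℝ} {a g C s τ : ℝ}

/-- Powers with an exponent larger than the critical one are controlled by the sum over the
critical powers. -/
theorem tsum_rpow_le_of_tailSum_le (he : ∀ j, 0 ≤ e j) (ha : 0 ≤ a) (hg : 0 < g) (hC : 0 < C)
    (hle : ∀ j, a ^ 2 * e (j + 1) ≤ a ^ 2 * (C * g ^ 2)) (hτ : 0 < τ) (hs : s ≤ τ) {C₃ : ℝ}
    (hsum : tailSum e g s ≤ ENNReal.ofReal C₃) :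
    ∑' j, ENNReal.ofReal ((a ^ 2 * e (j + 1)) ^ τ)
      ≤ ENNReal.ofReal (C ^ (τ - s) * C₃ * (a * g) ^ (2 * τ)) := by
  have hag : 0 ≤ a * g := by positivity
  have hterm : ∀ j, ENNReal.ofReal ((a ^ 2 * e (j + 1)) ^ τ)
      ≤ ENNReal.ofReal (C ^ (τ - s) * (a * g) ^ (2 * τ)) *
        (if 0 < e (j + 1) then ENNReal.ofReal ((e (j + 1) / g ^ 2) ^ s) else 0) := by
    intro j
    split_ifs with h
    · rw [← ENNReal.ofReal_mul (by positivity)]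
      refine ENNReal.ofReal_le_ofReal ?_
      by_cases ha0 : a = 0
      · rw [ha0]
        simp [Real.zero_rpow hτ.ne', Real.zero_rpow (mul_pos two_pos hτ).ne']
      have hy : 0 < e (j + 1) / g ^ 2 := by positivity
      have hyC : e (j + 1) / g ^ 2 ≤ C := by
        rw [div_le_iff₀ (by positivity)]
        exact le_of_mul_le_mul_left (hle j) (by positivity)
      calc (a ^ 2 * e (j + 1)) ^ τ = ((a * g) ^ 2 * (e (j + 1) / g ^ 2)) ^ τ := by
            congr 1; field_simp
        _ = (a * g) ^ (2 * τ) * ((e (j + 1) / g ^ 2) ^ (τ - s) * (e (j + 1) / g ^ 2) ^ s) := by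
            rw [Real.mul_rpow (by positivity) hy.le, ← Real.rpow_add hy, sub_add_cancel,
              ← Real.rpow_two (a * g),
              ← Real.rpow_mul hag]
        _ ≤ (a * g) ^ (2 * τ) * (C ^ (τ - s) * (e (j + 1) / g ^ 2) ^ s) := by
            gcongr
        _ = _ := by ring
    · have : e (j + 1) = 0 := le_antisymm (not_lt.1 h) (he _)
      simp [this, Real.zero_rpow hτ.ne']
  refine (ENNReal.tsum_le_tsum hterm).trans ?_
  rw [ENNReal.tsum_mul_left]
  refine (mul_le_mul_right hsum _).trans (le_of_eq ?_)
  rw [← ENNReal.ofReal_mul (by positivity)]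
  congr 1
  ring

/-- Powers with an exponent smaller than the critical one are bounded below by the sum over the
critical powers. -/
theorem le_tsum_rpow_of_le_tailSum (ha : 0 ≤ a) (hg : 0 < g) (hC : 0 < C)
    (hle : ∀ j, a ^ 2 * e (j + 1) ≤ a ^ 2 * (C * g ^ 2)) (hτ : 0 < τ) (hs : τ ≤ s) {C₂ : ℝ}
    (hsum : ENNReal.ofReal C₂ ≤ tailSum e g s) :
    ENNReal.ofReal (C₂ * C ^ (τ - s) * (a * g) ^ (2 * τ))
      ≤ ∑' j, ENNReal.ofReal ((a ^ 2 * e (j + 1)) ^ τ) := by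
  have hag : 0 ≤ a * g := by positivity
  have hterm : ∀ j, ENNReal.ofReal (C ^ (τ - s) * (a * g) ^ (2 * τ)) *
        (if 0 < e (j + 1) then ENNReal.ofReal ((e (j + 1) / g ^ 2) ^ s) else 0)
      ≤ ENNReal.ofReal ((a ^ 2 * e (j + 1)) ^ τ) := by
    intro j
    split_ifs with h
    · rw [← ENNReal.ofReal_mul (by positivity)]
      refine ENNReal.ofReal_le_ofReal ?_
      by_cases ha0 : a = 0
      · rw [ha0]
        simp [Real.zero_rpow hτ.ne', Real.zero_rpow (mul_pos two_pos hτ).ne']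
      have hy : 0 < e (j + 1) / g ^ 2 := by positivity
      have hyC : e (j + 1) / g ^ 2 ≤ C := by
        rw [div_le_iff₀ (by positivity)]
        exact le_of_mul_le_mul_left (hle j) (by positivity)
      calc C ^ (τ - s) * (a * g) ^ (2 * τ) * (e (j + 1) / g ^ 2) ^ s
          ≤ (e (j + 1) / g ^ 2) ^ (τ - s) * (a * g) ^ (2 * τ) * (e (j + 1) / g ^ 2) ^ s := by
            gcongr ?_ * _ * _
            exact Real.rpow_le_rpow_of_nonpos hy hyC (by linarith)
        _ = (a * g) ^ (2 * τ) * ((e (j + 1) / g ^ 2) ^ (τ - s) * (e (j + 1) / g ^ 2) ^ s) := by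
            ring
        _ = ((a * g) ^ 2 * (e (j + 1) / g ^ 2)) ^ τ := by
            rw [Real.mul_rpow (by positivity) hy.le, ← Real.rpow_add hy, sub_add_cancel,
              ← Real.rpow_two (a * g),
              ← Real.rpow_mul hag]
        _ = (a ^ 2 * e (j + 1)) ^ τ := by
            congr 1; field_simp
    · simp
  refine le_trans ?_ (ENNReal.tsum_le_tsum hterm)
  rw [ENNReal.tsum_mul_left]
  refine le_trans (le_of_eq ?_) (mul_le_mul_right hsum _)
  rw [← ENNReal.ofReal_mul (by positivity)]
  congr 1
  ring

theorem prod_one_add_le_exp_tsum {S : ℕ → ℝ≥0∞} {x : ℕ → ℝ} (hx : ∀ l, 0 ≤ x l)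
    (hs : Summable x) (hS : ∀ l, S l ≤ ENNReal.ofReal (x l)) (d : ℕ) :
    ∏ l : Fin d, (1 + S l) ≤ ENNReal.ofReal (Real.exp (∑' l, x l)) := by
  have h1 : ∀ l : Fin d, 1 + S l ≤ ENNReal.ofReal (Real.exp (x l)) := fun l => by
    refine (add_le_add_right (hS l) 1).trans ?_
    rw [← ENNReal.ofReal_one, ← ENNReal.ofReal_add zero_le_one (hx l)]
    refine ENNReal.ofReal_le_ofReal ?_
    linarith [Real.add_one_le_exp (x l)]
  refine (Finset.prod_le_prod' fun l _ => h1 l).trans ?_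
  rw [← ENNReal.ofReal_prod_of_nonneg fun l _ => (Real.exp_pos _).le, ← Real.exp_sum]
  refine ENNReal.ofReal_le_ofReal (Real.exp_le_exp.2 ?_)
  rw [Fin.sum_univ_eq_sum_range]
  exact hs.sum_le_tsum _ fun l _ => hx l

theorem sum_le_prod_one_add (S : ℕ → ℝ≥0∞) (d : ℕ) :
    ∑ l ∈ Finset.range d, S l ≤ ∏ l : Fin d, (1 + S l) := by
  rw [Fin.prod_univ_eq_prod_range (fun l => 1 + S l)]
  have h : 1 + ∑ l ∈ Finset.range d, S l ≤ ∏ l ∈ Finset.range d, (1 + S l) := by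
    induction d with
    | zero => simp
    | succ d ih =>
      rw [Finset.sum_range_succ, Finset.prod_range_succ]
      calc 1 + (∑ l ∈ Finset.range d, S l + S d)
          ≤ 1 + (∑ l ∈ Finset.range d, S l + S d) + (∑ l ∈ Finset.range d, S l) * S d :=
            le_self_add
        _ = (1 + ∑ l ∈ Finset.range d, S l) * (1 + S d) := by ring
        _ ≤ _ := by gcongr
  exact le_add_self.trans h

end Decay

/-! ### From error rates to information complexities -/

section Complexity

theorem one_div_two_mul_toReal (r : ℝ≥0∞) : (1 / (2 * r)).toReal = (1 / r).toReal / 2 := by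
  simp [ENNReal.toReal_mul]
  ring

theorem ofReal_inv_lt_of_toReal_lt {r : ℝ≥0∞} (hr : r ≠ 0) {q : ℝ} (hq0 : 0 < q)
    (hq : (1 / r).toReal < q) : ENNReal.ofReal (1 / q) < r := by
  rcases eq_or_ne r ⊤ with rfl | hrt
  · exact ENNReal.ofReal_lt_top
  · rw [ENNReal.ofReal_lt_iff_lt_toReal (by positivity) hrt]
    have h0 : 0 < r.toReal := ENNReal.toReal_pos hr hrt
    rw [ENNReal.toReal_div, ENNReal.toReal_one] at hq
    exact (one_div_lt h0 hq0).1 hq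

/-- Inverting an error rate: if `q > 1 / r`, then `n = ⌈(C / ε) ^ q⌉` functionals achieve the error
`ε`. -/
theorem preceqEps_of_preceqPow {F : ℕ → ℕ → ℝ≥0∞} {s : ℕ → ℝ≥0∞} {r : ℝ≥0∞} (hr : r ≠ 0)
    (h : PreceqPow F s (-(r : EReal))) :
    PreceqEps (fun d ε => ⨅ (n : ℕ) (_ : F d n ≤ ENNReal.ofReal ε * s d), (n : ℕ∞))
      (1 / r).toReal := by
  intro δ hδ
  set q := (1 / r).toReal + δ with hq
  have hq0 : 0 < q := by positivity
  have hlt : -(r : EReal) < ((-(1 / q) : ℝ) : EReal) := by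
    rw [EReal.coe_neg, EReal.neg_lt_neg_iff]
    have h1 := ofReal_inv_lt_of_toReal_lt hr hq0 (by linarith)
    have h2 : ((1 / q : ℝ) : EReal) = ((ENNReal.ofReal (1 / q) : ℝ≥0∞) : EReal) := by
      rw [EReal.coe_ennreal_ofReal, max_eq_left (by positivity)]
    rw [h2]
    exact_mod_cast h1
  obtain ⟨C, hC, hF⟩ := h _ hlt
  refine ⟨C ^ q + 1, by positivity, fun d hd ε hε0 hε1 => ?_⟩
  have hpos : 0 < (C / ε) ^ q := by positivity
  set n := ⌈(C / ε) ^ q⌉₊ with hn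
  have hn1 : 1 ≤ n := Nat.one_le_iff_ne_zero.2 (Nat.ceil_pos.2 hpos).ne'
  have hnle : (C / ε) ^ q ≤ n := Nat.le_ceil _
  have h1 : F d n ≤ ENNReal.ofReal ε * s d := by
    refine (hF d hd n hn1).trans ?_
    rw [mul_right_comm, ← ENNReal.ofReal_mul hC.le]
    gcongr
    calc C * (n : ℝ) ^ (-(1 / q)) ≤ C * ((C / ε) ^ q) ^ (-(1 / q)) := by
          gcongr C * ?_
          exact Real.rpow_le_rpow_of_nonpos hpos hnle (by rw [neg_nonpos]; positivity)
      _ = C * (C / ε)⁻¹ := by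
          rw [← Real.rpow_mul (by positivity), mul_neg, mul_one_div_cancel hq0.ne',
            Real.rpow_neg_one]
      _ = ε := by field_simp
  have h2 : (⨅ (n : ℕ) (_ : F d n ≤ ENNReal.ofReal ε * s d), (n : ℕ∞)) ≤ n :=
    iInf₂_le n h1
  have h3 : (((⨅ (n : ℕ) (_ : F d n ≤ ENNReal.ofReal ε * s d), (n : ℕ∞)) : ℕ∞) : ℝ≥0∞)
      ≤ ((n : ℕ∞) : ℝ≥0∞) := by exact_mod_cast h2
  refine h3.trans ?_
  rw [ENat.toENNReal_coe, ← ENNReal.ofReal_natCast]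
  refine ENNReal.ofReal_le_ofReal ?_
  have h4 : 1 ≤ ε ^ (-q) := Real.one_le_rpow_of_pos_of_le_one_of_nonpos hε0 hε1.le (by linarith)
  calc (n : ℝ) ≤ (C / ε) ^ q + 1 := (Nat.ceil_lt_add_one hpos.le).le
    _ = C ^ q * ε ^ (-q) + 1 := by
        rw [Real.div_rpow hC.le hε0.le, Real.rpow_neg hε0.le, div_eq_mul_inv]
    _ ≤ C ^ q * ε ^ (-q) + ε ^ (-q) := by gcongr
    _ = (C ^ q + 1) * ε ^ (-q) := by ring

theorem strongBound_of_preceqEps {N : ℕ → ℝ → ℕ∞} {p δ : ℝ} (h : PreceqEps N p) (hδ : 0 < δ) :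
    StrongBound N (p + δ) := by
  obtain ⟨C, -, hC⟩ := h δ hδ
  exact ⟨C, hC⟩

end Complexity

/-! ### Normalized weights of the product spaces -/

section Normalized

variable {X : Type*} [MeasurableSpace X]

/-- The numbers `w i` behave like the squares of the singular numbers of the embedding of `H` into
`L²(μ)`, divided by the square of its norm: their power sums bound the minimal errors, and the
minimal errors bound their counting function. -/
structure IsNormalizedWeight (H : Type*) [NormedAddCommGroup H] [InnerProductSpace ℝ H]
    [RKHS ℝ H X ℝ] (μ : Measure X) {I : Type*} (w : I → ℝ) : Prop where
  nonneg : ∀ i, 0 ≤ w i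
  le_one : ∀ i, w i ≤ 1
  embeddingNorm_pos : 0 < embeddingNorm H μ
  embeddingNorm_le_one : embeddingNorm H μ ≤ 1
  minimalError_le : ∀ {τ M : ℝ}, 0 < τ → 0 ≤ M → ∑' i, ENNReal.ofReal (w i ^ τ) ≤ ENNReal.ofReal M →
    ∀ {n : ℕ}, 1 ≤ n →
      minimalError H μ n ≤ embeddingNorm H μ * ENNReal.ofReal ((M / n) ^ (1 / (2 * τ)))
  encard_le : ∀ {ε : ℝ}, 0 < ε → ∀ {n : ℕ},
    minimalError H μ n ≤ ENNReal.ofReal ε * embeddingNorm H μ → {i | ε ^ 2 < w i}.encard ≤ n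

/-- The normalized weights of a tensor product are the products of the univariate ones, so their
power sums factorize; the largest univariate weight contributes the `1` in each factor. -/
theorem exists_isNormalizedWeight_pi {d : ℕ} {Y : Type*} [MeasurableSpace Y]
    {μ : Fin d → Measure Y} [∀ l, SigmaFinite (μ l)] {ι : Fin d → Type u} {E : Fin d → Type*}
    [∀ l, NormedAddCommGroup (E l)] [∀ l, InnerProductSpace ℝ (E l)] {Φ : ∀ l, Y → E l}
    {b : ∀ l, HilbertBasis (ι l) ℝ (E l)} (h : ∀ l, IsFeatureMap (μ l) (Φ l))
    (hb : ∀ l, Diagonalizes (b l) (h l).toL2) {i₀ : ∀ l, ι l}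
    (hi₀ : ∀ l i, ‖(h l).toL2 (b l i)‖ ^ 2 ≤ ‖(h l).toL2 (b l (i₀ l))‖ ^ 2)
    (hpos : ∀ l, 0 < ‖(h l).toL2 (b l (i₀ l))‖ ^ 2)
    (hle : ∀ l, ‖(h l).toL2 (b l (i₀ l))‖ ^ 2 ≤ 1)
    (H : Type*) [NormedAddCommGroup H] [InnerProductSpace ℝ H] [CompleteSpace H]
    [RKHS ℝ H (Fin d → Y) ℝ]
    (hK : ∀ x t, reproducingKernel H x t = ∏ l, inner ℝ (Φ l (x l)) (Φ l (t l))) :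
    ∃ w : (∀ l, ι l) → ℝ, IsNormalizedWeight H (Measure.pi μ) w ∧
      ∀ τ : ℝ, 0 < τ → ∑' i, ENNReal.ofReal (w i ^ τ)
        = ∏ l, (1 + ∑' i : {i // i ≠ i₀ l}, ENNReal.ofReal
          ((‖(h l).toL2 (b l i)‖ ^ 2 / ‖(h l).toL2 (b l (i₀ l))‖ ^ 2) ^ τ)) := by
  have hΦ := isFeatureMap_prodSection b h
  have hd : Diagonalizes (stdBasis _) hΦ.toL2 := diagonalizes_prodSection h hb
  have hw : ∀ i, ‖hΦ.toL2 (stdBasis _ i)‖ ^ 2 = ∏ l, ‖(h l).toL2 (b l (i l))‖ ^ 2 :=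
    norm_toL2_prodSection_sq h
  have hK' : ∀ x t, inner ℝ (prodSection b Φ x) (prodSection b Φ t) = reproducingKernel H x t :=
    fun x t => by rw [inner_prodSection, hK]
  have hmax : ∀ i, ‖hΦ.toL2 (stdBasis _ i)‖ ^ 2 ≤ ‖hΦ.toL2 (stdBasis _ i₀)‖ ^ 2 := fun i => by
    rw [hw, hw]
    exact Finset.prod_le_prod (fun l _ => sq_nonneg _) fun l _ => hi₀ l (i l)
  have hpos' : 0 < ‖hΦ.toL2 (stdBasis _ i₀)‖ ^ 2 := by
    rw [hw]
    exact Finset.prod_pos fun l _ => hpos l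
  have hle' : ‖hΦ.toL2 (stdBasis _ i₀)‖ ^ 2 ≤ 1 := by
    rw [hw]
    exact Finset.prod_le_one (fun l _ => sq_nonneg _) fun l _ => hle l
  refine ⟨fun i => ‖hΦ.toL2 (stdBasis _ i)‖ ^ 2 / ‖hΦ.toL2 (stdBasis _ i₀)‖ ^ 2, ?_, ?_⟩
  · refine ⟨fun i => by positivity, fun i => (div_le_one hpos').2 (hmax i), ?_, ?_,
      fun hτ hM hsum n hn =>
        minimalError_le_of_tsum_rpow_le H hΦ hK' hd hmax hpos' hτ hM hsum hn,
      fun hε n hn => encard_le_of_minimalError_le H hΦ hK' hd hmax hpos' hε hn⟩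
    · rw [embeddingNorm_eq H hΦ hK' hd hmax]
      exact ENNReal.ofReal_pos.2 (Real.sqrt_pos.2 hpos')
    · rw [embeddingNorm_eq H hΦ hK' hd hmax]
      exact ENNReal.ofReal_le_one.2 (Real.sqrt_le_one.2 hle')
  · intro τ hτ
    have h1 : ∀ i : ∀ l, ι l, ENNReal.ofReal
        ((‖hΦ.toL2 (stdBasis _ i)‖ ^ 2 / ‖hΦ.toL2 (stdBasis _ i₀)‖ ^ 2) ^ τ)
        = ∏ l, ENNReal.ofReal
          ((‖(h l).toL2 (b l (i l))‖ ^ 2 / ‖(h l).toL2 (b l (i₀ l))‖ ^ 2) ^ τ) := fun i => by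
      rw [hw, hw, ← Finset.prod_div_distrib, ← Real.finsetProd_rpow _ _ fun l _ => by positivity,
        ENNReal.ofReal_prod_of_nonneg fun l _ => by positivity]
    simp only [h1]
    rw [tsum_pi_prod fun l k => ENNReal.ofReal
      ((‖(h l).toL2 (b l k)‖ ^ 2 / ‖(h l).toL2 (b l (i₀ l))‖ ^ 2) ^ τ)]
    refine Finset.prod_congr rfl fun l _ => ?_
    rw [tsum_eq_add_tsum_ne _ (i₀ l), div_self (hpos l).ne', Real.one_rpow, ENNReal.ofReal_one]

end Normalized

/-! ### Rates and exponents of a sequence of spaces -/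

section Sequence

variable {Y : Type*} [MeasurableSpace Y] {H : ℕ → Type*} [∀ d, NormedAddCommGroup (H d)]
  [∀ d, InnerProductSpace ℝ (H d)] [∀ d, RKHS ℝ (H d) (Fin d → Y) ℝ]
  {μ : ∀ d, Measure (Fin d → Y)} {I : ℕ → Type*} {w : ∀ d, I d → ℝ}

/-- Only the negative exponents `t = -q` need the power sums: for `t ≥ 0` the trivial bound
`e(n) ≤ e(0) = ‖I_d‖` suffices. -/
theorem preceqPow_of_isNormalizedWeight
    (hw : ∀ d, IsNormalizedWeight (H d) (μ d) (w d)) {r : ℝ≥0∞}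
    (hsum : ∀ t : ℝ, 0 < t → ENNReal.ofReal t < r → ∃ M : ℝ, 0 ≤ M ∧ ∀ d,
      ∑' i, ENNReal.ofReal (w d i ^ (1 / (2 * t))) ≤ ENNReal.ofReal M) :
    PreceqPow (fun d n => minimalError (H d) (μ d) n) (fun d => embeddingNorm (H d) (μ d))
      (-(r : EReal)) := by
  intro t ht
  rcases le_or_gt 0 t with ht0 | ht0
  · refine ⟨1, one_pos, fun d _ n hn => ?_⟩
    simp only [ENNReal.ofReal_one, one_mul]
    rw [← minimalError_zero]
    refine (minimalError_antitone (H d) (Nat.zero_le n)).trans (le_mul_of_one_le_right' ?_)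
    rw [ENNReal.one_le_ofReal]
    exact Real.one_le_rpow (by exact_mod_cast hn) ht0
  · obtain ⟨q, rfl⟩ : ∃ q, t = -q := ⟨-t, (neg_neg t).symm⟩
    have hq0 : 0 < q := by linarith
    have hqr : ENNReal.ofReal q < r := by
      rw [EReal.coe_neg, EReal.neg_lt_neg_iff] at ht
      have h2 : ((q : ℝ) : EReal) = ((ENNReal.ofReal q : ℝ≥0∞) : EReal) := by
        rw [EReal.coe_ennreal_ofReal, max_eq_left hq0.le]
      rw [h2] at ht
      exact_mod_cast ht
    obtain ⟨M, hM, hMd⟩ := hsum q hq0 hqr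
    refine ⟨M ^ q + 1, by positivity, fun d _ n hn => ?_⟩
    refine ((hw d).minimalError_le (by positivity) hM (hMd d) hn).trans ?_
    have h1 : 1 / (2 * (1 / (2 * q))) = q := by field_simp
    rw [h1, mul_comm (ENNReal.ofReal _), mul_assoc, ← ENNReal.ofReal_mul (by positivity)]
    gcongr
    rw [Real.div_rpow hM (by positivity), Real.rpow_neg (by positivity), div_eq_mul_inv]
    gcongr
    linarith

/-- A strong bound with the power `p` controls, uniformly in the dimension, the sums of all powers
of the normalized weights with exponents larger than `p / 2`. -/
theorem exists_tsum_rpow_le_of_strongBound (hw : ∀ d, IsNormalizedWeight (H d) (μ d) (w d)) {p : ℝ}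
    (hp : StrongBound (fun d ε => complexityNorm (H d) (μ d) ε) p) {τ : ℝ} (hτ0 : 0 < τ)
    (hτ : p / 2 < τ) : ∃ M : ℝ≥0∞, M ≠ ⊤ ∧ ∀ d, 1 ≤ d →
      ∑' i, ENNReal.ofReal (w d i ^ τ) ≤ M := by
  obtain ⟨C, hC⟩ := hp
  refine ⟨_, ENNReal.mul_ne_top ENNReal.ofReal_ne_top
    (lintegral_Ioo_rpow_ne_top (C := C) (q := τ - p / 2) (by linarith)), fun d hd =>
    tsum_rpow_le_of_encard_le_rpow (s := p / 2) (C := C) (hw d).nonneg (hw d).le_one hτ0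
      fun t ht0 ht1 => ?_⟩
  have hs0 : 0 < √t := Real.sqrt_pos.2 ht0
  have hs1 : √t < 1 := (Real.sqrt_lt' one_pos).2 (by simpa using ht1)
  have h1 := hC d hd (√t) hs0 hs1
  have h2 : √t ^ (-p) = t ^ (-(p / 2)) := by
    rw [Real.sqrt_eq_rpow, ← Real.rpow_mul ht0.le]
    congr 1; ring
  rw [h2] at h1
  refine le_trans ?_ h1
  have h3 : complexityNorm (H d) (μ d) √t ≠ ⊤ := by
    intro htop
    simp [htop] at h1
  obtain ⟨k, hk⟩ := ENat.ne_top_iff_exists.1 h3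
  have h4 : complexityNorm (H d) (μ d) √t < ((k + 1 : ℕ) : ℕ∞) := by
    rw [← hk]; exact_mod_cast Nat.lt_succ_self k
  simp only [complexityNorm, iInf_lt_iff] at h4
  obtain ⟨n, hn, hnk⟩ := h4
  have h5 := (hw d).encard_le hs0 hn
  rw [Real.sq_sqrt ht0.le] at h5
  have h6 : {i | t < w d i}.encard ≤ complexityNorm (H d) (μ d) √t := by
    rw [← hk]
    exact h5.trans (by exact_mod_cast Nat.lt_succ_iff.1 (by exact_mod_cast hnk))
  exact_mod_cast h6

/-- At least one functional is needed, hence no negative power is admissible. -/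
theorem nonneg_of_strongBound (hw : ∀ d, IsNormalizedWeight (H d) (μ d) (w d)) {p : ℝ}
    (hp : StrongBound (fun d ε => complexityNorm (H d) (μ d) ε) p) : 0 ≤ p := by
  by_contra! hneg
  obtain ⟨C, hC⟩ := hp
  have hlim : Tendsto (fun ε : ℝ => C * ε ^ (-p)) (𝓝[>] 0) (𝓝 0) := by
    have h1 : Tendsto (fun ε : ℝ => C * ε ^ (-p)) (𝓝 0) (𝓝 (C * 0 ^ (-p))) :=
      (tendsto_id.rpow_const (Or.inr (by linarith))).const_mul C
    rw [Real.zero_rpow (by linarith), mul_zero] at h1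
    exact h1.mono_left nhdsWithin_le_nhds
  obtain ⟨ε, hε, hε0, hε1⟩ := ((hlim.eventually (gt_mem_nhds one_pos)).and
    (Ioo_mem_nhdsGT (one_pos : (0 : ℝ) < 1))).exists
  have h1 := (hC 1 le_rfl ε hε0 hε1).trans_lt (ENNReal.ofReal_lt_one.2 hε)
  have h2 : complexityNorm (H 1) (μ 1) ε < 1 := by exact_mod_cast h1
  simp only [complexityNorm, iInf_lt_iff] at h2
  obtain ⟨n, hn, hn1⟩ := h2
  have hn0 : n = 0 := by
    have : n < 1 := by exact_mod_cast hn1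
    omega
  rw [hn0, minimalError_zero] at hn
  have hfin : embeddingNorm (H 1) (μ 1) ≠ ⊤ :=
    ((hw 1).embeddingNorm_le_one.trans_lt ENNReal.one_lt_top).ne
  have h3 : ENNReal.ofReal ε * embeddingNorm (H 1) (μ 1) < 1 * embeddingNorm (H 1) (μ 1) :=
    ENNReal.mul_lt_mul_left (hw 1).embeddingNorm_pos.ne' hfin (ENNReal.ofReal_lt_one.2 hε1)
  rw [one_mul] at h3
  exact absurd hn (not_le.2 h3)

end Sequence

theorem isProbabilityMeasure_marginal {ρ : ℝ → ℝ} (hρ0 : ∀ x, 0 ≤ ρ x) (hρ1 : ∫ x, ρ x = 1) :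
    IsProbabilityMeasure (marginal ρ) := by
  refine ⟨?_⟩
  have hi : Integrable ρ := by
    by_contra h
    rw [integral_undef h] at hρ1
    exact zero_ne_one hρ1
  rw [marginal, withDensity_apply _ MeasurableSet.univ, Measure.restrict_univ,
    ← ofReal_integral_eq_lintegral_ofReal hi (ae_of_all _ hρ0), hρ1, ENNReal.ofReal_one]

/-! ### Univariate weights under the assumptions on the kernels -/

section Assumptions

/-- The sum of the `τ`-th powers of the normalized weights of `1 - a² + a² K` but the largest is of
the order `(a g) ^ (2 τ)`, from above if `τ` is at least the critical exponent `s`, and from below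
if `τ` is at most `s`. -/
theorem exists_hat_weights_rpow {X : Type*} [MeasurableSpace X] {μ : Measure X}
    [IsProbabilityMeasure μ] {H : Type u} [NormedAddCommGroup H] [InnerProductSpace ℝ H]
    [RKHS ℝ H X ℝ] [CompleteSpace H] {a g s C₁ C₂ C₃ : ℝ} (ha : 0 ≤ a ∧ a ≤ 1) (hg : 0 < g)
    (hC₁ : 0 < C₁) (hC₂ : 0 < C₂) (hC₃ : 0 < C₃) (h : IsFeatureMap μ (kernelSection H (X := X)))
    (hm : Measurable fun z : X × X => reproducingKernel H z.1 z.2)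
    (htr : ∫ x, reproducingKernel H x x ∂μ = 1)
    (hD : 1 - C₁ * g ^ 2 ≤ ∫ z : X × X, reproducingKernel H z.1 z.2 ∂(μ.prod μ))
    (htail : ENNReal.ofReal C₂ ≤ tailSum (eigenvalue H μ) g s ∧
      tailSum (eigenvalue H μ) g s ≤ ENNReal.ofReal C₃)
    (h' : IsFeatureMap μ (hatSection H (X := X) a)) :
    ∃ (ι : Type u) (b : HilbertBasis ι ℝ (WithLp 2 (ℝ × H))) (i₀ : ι),
      Diagonalizes b h'.toL2 ∧ (∀ i, ‖h'.toL2 (b i)‖ ^ 2 ≤ ‖h'.toL2 (b i₀)‖ ^ 2) ∧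
      0 < ‖h'.toL2 (b i₀)‖ ^ 2 ∧ ‖h'.toL2 (b i₀)‖ ^ 2 ≤ 1 ∧
      1 - C₁ * (a * g) ^ 2 ≤ ‖h'.toL2 (b i₀)‖ ^ 2 ∧
      (∀ c, 0 < c → c ≤ ‖h'.toL2 (b i₀)‖ ^ 2 → ∀ τ : ℝ, 0 < τ → s ≤ τ →
        ∑' i : {i // i ≠ i₀}, ENNReal.ofReal ((‖h'.toL2 (b i)‖ ^ 2 / ‖h'.toL2 (b i₀)‖ ^ 2) ^ τ)
          ≤ ENNReal.ofReal (c ^ (-τ) * (C₁ ^ τ + C₁ ^ (τ - s) * C₃) * (a * g) ^ (2 * τ))) ∧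
      ∀ τ : ℝ, 0 < τ → τ ≤ s → ENNReal.ofReal (C₂ * C₁ ^ (τ - s) * (a * g) ^ (2 * τ)) ≤
        ∑' i : {i // i ≠ i₀}, ENNReal.ofReal ((‖h'.toL2 (b i)‖ ^ 2 / ‖h'.toL2 (b i₀)‖ ^ 2) ^ τ)
      := by
  have hx0 : 0 ≤ a * g := mul_nonneg ha.1 hg.le
  have heig : ∃ j, 0 < eigenvalue H μ j := by
    by_contra! hcon
    have h2 : tailSum (eigenvalue H μ) g s = 0 := by
      simp [tailSum, fun j => not_lt.2 (hcon j)]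
    rw [h2] at htail
    exact absurd htail.1 (not_le.2 (ENNReal.ofReal_pos.2 hC₂))
  obtain ⟨ι, b, i₀, hb, hi₀, hpos, hle1, hge, hle, hsums⟩ :=
    exists_hat_weights ha h hm htr hD heig h'
  refine ⟨ι, b, i₀, hb, hi₀, hpos, hle1, ?_, fun c hc0 hc τ hτ0 hsτ => ?_, fun τ hτ0 hτs => ?_⟩
  · calc 1 - C₁ * (a * g) ^ 2 = 1 - a ^ 2 * (C₁ * g ^ 2) := by ring
      _ ≤ _ := hge
  · have h1 : ∀ i : {i // i ≠ i₀},
        ENNReal.ofReal ((‖h'.toL2 (b i)‖ ^ 2 / ‖h'.toL2 (b i₀)‖ ^ 2) ^ τ)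
        ≤ ENNReal.ofReal (c ^ (-τ)) * ENNReal.ofReal ((‖h'.toL2 (b i)‖ ^ 2) ^ τ) := fun i => by
      rw [← ENNReal.ofReal_mul (by positivity)]
      refine ENNReal.ofReal_le_ofReal ?_
      rw [Real.div_rpow (sq_nonneg _) (sq_nonneg _), div_eq_mul_inv, mul_comm,
        ← Real.rpow_neg (sq_nonneg _)]
      refine mul_le_mul_of_nonneg_right ?_ (Real.rpow_nonneg (sq_nonneg _) _)
      exact Real.rpow_le_rpow_of_nonpos hc0 hc (by linarith)
    refine (ENNReal.tsum_le_tsum h1).trans ?_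
    rw [ENNReal.tsum_mul_left]
    have h2 := tsum_rpow_le_of_tailSum_le (eigenvalue_nonneg h) ha.1 hg hC₁ hle hτ0 hsτ htail.2
    have h3 : (a ^ 2 * (C₁ * g ^ 2)) ^ τ = C₁ ^ τ * (a * g) ^ (2 * τ) := by
      rw [Real.rpow_mul hx0, Real.rpow_two, ← Real.mul_rpow hC₁.le (sq_nonneg _)]
      congr 1
      ring
    refine (mul_le_mul_right (((hsums τ hτ0).2).trans (add_le_add_right h2 _)) _).trans
      (le_of_eq ?_)
    rw [h3, ← ENNReal.ofReal_add (by positivity) (by positivity),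
      ← ENNReal.ofReal_mul (by positivity)]
    congr 1
    ring
  · refine (le_tsum_rpow_of_le_tailSum ha.1 hg hC₁ hle hτ0 hτs htail.1).trans
      ((hsums τ hτ0).1.trans ?_)
    refine ENNReal.tsum_le_tsum fun i => ENNReal.ofReal_le_ofReal ?_
    exact Real.rpow_le_rpow (sq_nonneg _) (le_div_self (sq_nonneg _) hpos hle1) hτ0.le


/-- The spaces with the product kernels have normalized weights whose power sums are products over
the coordinates, with factors `1 + S τ l`, where `S τ l` is of the order `(α l * γ l) ^ (2 τ)`. -/
theorem exists_product_weights {ν : Measure ℝ} [IsProbabilityMeasure ν]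
    {K : ℝ → ℝ → ℝ → ℝ} {G : ℕ → Type u} [∀ l, NormedAddCommGroup (G l)]
    [∀ l, InnerProductSpace ℝ (G l)] [∀ l, CompleteSpace (G l)] [∀ l, RKHS ℝ (G l) ℝ ℝ]
    {α γ : ℕ → ℝ} (hG : ∀ l x t, reproducingKernel (G l) x t = K (γ l) x t)
    (hKm : ∀ l, Measurable (fun z : ℝ × ℝ => K (γ l) z.1 z.2))
    (hKtrace : ∀ l, ∫ t, K (γ l) t t ∂ν = 1)
    (hα : ∀ l, 0 ≤ α l ∧ α l ≤ 1) (hγ : ∀ l, 0 < γ l)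
    {H : ℕ → Type*} [∀ d, NormedAddCommGroup (H d)] [∀ d, InnerProductSpace ℝ (H d)]
    [∀ d, CompleteSpace (H d)] [∀ d, RKHS ℝ (H d) (Fin d → ℝ) ℝ]
    (hH : ∀ d x t, reproducingKernel (H d) x t = productKernel K α γ d x t)
    (hlim : Tendsto (fun l => α l * γ l) atTop (𝓝 0))
    {s C₁ C₂ C₃ : ℝ} (hC₁ : 0 < C₁) (hC₂ : 0 < C₂) (hC₃ : 0 < C₃)
    (hD : ∀ l, 1 - C₁ * γ l ^ 2 ≤ ∫ z : ℝ × ℝ, K (γ l) z.1 z.2 ∂(ν.prod ν))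
    (htail : ∀ l, ENNReal.ofReal C₂ ≤ tailSum (eigenvalue (G l) ν) (γ l) s ∧
      tailSum (eigenvalue (G l) ν) (γ l) s ≤ ENNReal.ofReal C₃) :
    ∃ (I : ℕ → Type u) (w : ∀ d, I d → ℝ) (S : ℝ → ℕ → ℝ≥0∞),
      (∀ d, IsNormalizedWeight (H d) (Measure.pi fun _ : Fin d => ν) (w d)) ∧
      (∀ d (τ : ℝ), 0 < τ → ∑' i, ENNReal.ofReal (w d i ^ τ) = ∏ l : Fin d, (1 + S τ l)) ∧
      (∀ τ : ℝ, 0 < τ → s ≤ τ → ∃ B : ℝ, 0 ≤ B ∧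
        ∀ l, S τ l ≤ ENNReal.ofReal (B * (α l * γ l) ^ (2 * τ))) ∧
      (∀ τ : ℝ, 0 < τ → τ ≤ s → ∃ B : ℝ, 0 < B ∧
        ∀ l, ENNReal.ofReal (B * (α l * γ l) ^ (2 * τ)) ≤ S τ l) := by
  simp only [← hG] at hKm hKtrace hD
  have hint : ∀ l, Integrable (fun x => reproducingKernel (G l) x x) ν := fun l => by
    by_contra h
    exact one_ne_zero ((hKtrace l).symm.trans (integral_undef h))
  have hfeat : ∀ l, IsFeatureMap ν (kernelSection (G l) (X := ℝ)) := fun l =>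
    isFeatureMap_kernelSection (G l) (hKm l) (hint l)
  have hhat : ∀ l, IsFeatureMap ν (hatSection (G l) (X := ℝ) (α l)) := fun l =>
    isFeatureMap_hatSection (hα l) (hfeat l)
  choose ι b i₀ hb hi₀ hpos hle1 hge hupper hlower using fun l =>
    exists_hat_weights_rpow (hα l) (hγ l) hC₁ hC₂ hC₃ (hfeat l) (hKm l) (hKtrace l) (hD l)
      (htail l) (hhat l)
  have hex : ∀ d, ∃ w : (∀ l : Fin d, ι l) → ℝ,
      IsNormalizedWeight (H d) (Measure.pi fun _ : Fin d => ν) w ∧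
      ∀ τ : ℝ, 0 < τ → ∑' i, ENNReal.ofReal (w i ^ τ)
        = ∏ l : Fin d, (1 + ∑' i : {i // i ≠ i₀ l}, ENNReal.ofReal
          ((‖(hhat l).toL2 (b l i)‖ ^ 2 / ‖(hhat l).toL2 (b l (i₀ l))‖ ^ 2) ^ τ)) := fun d =>
    exists_isNormalizedWeight_pi (μ := fun _ : Fin d => ν) (ι := fun l : Fin d => ι l)
      (E := fun l : Fin d => WithLp 2 (ℝ × G l)) (Φ := fun l : Fin d => hatSection (G l) (α l))
      (b := fun l : Fin d => b l) (i₀ := fun l : Fin d => i₀ l)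
      (fun l => hhat l) (fun l => hb l) (fun l => hi₀ l)
      (fun l => hpos l) (fun l => hle1 l) (H d) fun x t => by
        rw [hH, productKernel]
        refine Finset.prod_congr rfl fun l _ => ?_
        rw [hatKernel, inner_hatSection_hatSection (hα l), hG]
  choose w hw hwsum using hex
  -- The largest univariate weights are bounded away from `0`, since they tend to `1`.
  obtain ⟨c, hc0, hc⟩ : ∃ c, 0 < c ∧ ∀ l, c ≤ ‖(hhat l).toL2 (b l (i₀ l))‖ ^ 2 := by
    refine exists_pos_forall_le hpos (c := 1 / 2) (by norm_num) ?_
    have h3 : Tendsto (fun l => C₁ * (α l * γ l) ^ 2) atTop (𝓝 0) := by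
      simpa using (hlim.pow 2).const_mul C₁
    filter_upwards [h3.eventually (gt_mem_nhds (by norm_num : (0 : ℝ) < 1 / 2))] with l hl
    linarith [hge l]
  exact ⟨_, w, _, hw, hwsum,
    fun τ hτ0 hτ => ⟨_, by positivity, fun l => hupper l c hc0 (hc l) τ hτ0 hτ⟩,
    fun τ hτ0 hτ => ⟨_, by positivity, fun l => hlower l τ hτ0 hτ⟩⟩

end Assumptions

/-! ### Power sums and the decay rate -/

section Bounds

variable {α γ : ℕ → ℝ} {I : ℕ → Type*} {w : ∀ d, I d → ℝ} {S : ℝ → ℕ → ℝ≥0∞}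

theorem exists_tsum_rpow_le_of_lt_decayRate (hx0 : ∀ l, 0 ≤ α l * γ l)
    (hwsum : ∀ d (τ : ℝ), 0 < τ →
      ∑' i, ENNReal.ofReal (w d i ^ τ) = ∏ l : Fin d, (1 + S τ l))
    (hupper : ∀ τ : ℝ, 0 < τ → (1 / (2 * decayRate α γ)).toReal ≤ τ → ∃ B : ℝ, 0 ≤ B ∧
      ∀ l, S τ l ≤ ENNReal.ofReal (B * (α l * γ l) ^ (2 * τ)))
    (t : ℝ) (ht0 : 0 < t) (ht : ENNReal.ofReal t < decayRate α γ) :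
    ∃ M : ℝ, 0 ≤ M ∧ ∀ d,
      ∑' i, ENNReal.ofReal (w d i ^ (1 / (2 * t))) ≤ ENNReal.ofReal M := by
  have hτ0 : 0 < 1 / (2 * t) := by positivity
  have hsτ : (1 / (2 * decayRate α γ)).toReal ≤ 1 / (2 * t) := by
    rw [one_div_two_mul_toReal]
    rcases eq_or_ne (decayRate α γ) ⊤ with h | h
    · simpa [h] using ht0.le
    · have h2 : t < (decayRate α γ).toReal := (ENNReal.ofReal_lt_iff_lt_toReal ht0.le h).1 ht
      have h3 := one_div_le_one_div_of_le ht0 h2.le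
      have h4 : 1 / (2 * t) = 1 / t / 2 := by field_simp
      rw [ENNReal.toReal_div, ENNReal.toReal_one, h4]
      linarith
  obtain ⟨B, hB0, hB⟩ := hupper _ hτ0 hsτ
  have hx := (summable_rpow_of_lt_decayRate hx0 ht0 ht).2
  have h2τ : 2 * (1 / (2 * t)) = 1 / t := by field_simp
  refine ⟨_, (Real.exp_pos (∑' l, B * (α l * γ l) ^ (2 * (1 / (2 * t))))).le, fun d => ?_⟩
  rw [hwsum d _ hτ0]
  rw [← h2τ] at hx
  exact prod_one_add_le_exp_tsum (fun l => mul_nonneg hB0 (Real.rpow_nonneg (hx0 l) _))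
    (hx.mul_left B) hB d

/-- If all power sums with exponents above `p / 2` are bounded in the dimension, then `p` is at
least `1 / decayRate α γ`: otherwise the power sums would be bounded for some exponent `τ` below
the critical one, `∑ (α l * γ l) ^ (2 τ)` would converge, and the decay rate would be at least
`1 / (2 τ)`, which it is not. -/
theorem le_of_tsum_rpow_le (hx0 : ∀ l, 0 ≤ α l * γ l) (hr0 : decayRate α γ ≠ 0)
    (hwsum : ∀ d (τ : ℝ), 0 < τ →
      ∑' i, ENNReal.ofReal (w d i ^ τ) = ∏ l : Fin d, (1 + S τ l))
    (hlower : ∀ τ : ℝ, 0 < τ → τ ≤ (1 / (2 * decayRate α γ)).toReal → ∃ B : ℝ, 0 < B ∧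
      ∀ l, ENNReal.ofReal (B * (α l * γ l) ^ (2 * τ)) ≤ S τ l)
    {p : ℝ} (hp : 0 ≤ p)
    (hsum : ∀ τ : ℝ, 0 < τ → p / 2 < τ → ∃ M : ℝ≥0∞, M ≠ ⊤ ∧ ∀ d, 1 ≤ d →
      ∑' i, ENNReal.ofReal (w d i ^ τ) ≤ M) :
    (1 / decayRate α γ).toReal ≤ p := by
  by_contra! hlt
  have hrt : decayRate α γ ≠ ⊤ := fun h => by
    rw [h] at hlt
    simp at hlt
    linarith
  have hr1 : 0 < (decayRate α γ).toReal := ENNReal.toReal_pos hr0 hrt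
  rw [ENNReal.toReal_div, ENNReal.toReal_one] at hlt
  obtain ⟨τ, hpτ, hτs⟩ := exists_between (div_lt_div_of_pos_right hlt two_pos)
  have hτ0 : 0 < τ := by linarith
  obtain ⟨M, hM, hMd⟩ := hsum τ hτ0 hpτ
  obtain ⟨B, hB0, hB⟩ := hlower τ hτ0 (by
    rw [one_div_two_mul_toReal, ENNReal.toReal_div, ENNReal.toReal_one]
    exact hτs.le)
  have h0 : ∀ l, 0 ≤ B * (α l * γ l) ^ (2 * τ) := fun l =>
    mul_nonneg hB0.le (Real.rpow_nonneg (hx0 l) _)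
  have hs : Summable fun l => B * (α l * γ l) ^ (2 * τ) := by
    refine summable_of_sum_range_le (c := M.toReal) h0 fun d => ?_
    rcases Nat.eq_zero_or_pos d with rfl | hd
    · simp
    rw [← ENNReal.ofReal_le_iff_le_toReal hM, ENNReal.ofReal_sum_of_nonneg fun l _ => h0 l]
    refine (Finset.sum_le_sum fun l _ => hB l).trans ((sum_le_prod_one_add _ d).trans ?_)
    rw [← hwsum d τ hτ0]
    exact hMd d hd
  rw [summable_mul_left_iff hB0.ne'] at hs
  have h1 : ENNReal.ofReal (1 / (2 * τ)) ≤ decayRate α γ :=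
    ofReal_le_decayRate (by positivity) (by simpa only [one_div_one_div] using hs)
  rw [ENNReal.ofReal_le_iff_le_toReal hrt, one_div_le (by positivity) hr1] at h1
  linarith

end Bounds

end KernelApprox

end

open KernelApprox in
theorem theorem3
    -- the probability density on the real line
    (ρ : ℝ → ℝ) (hρm : Measurable ρ) (hρ0 : ∀ x, 0 ≤ ρ x) (hρ1 : ∫ x, ρ x = 1)
    -- the kernels `K_g`, `g > 0`, with the spaces that they reproduce
    (K : ℝ → ℝ → ℝ → ℝ)
    (hKm : ∀ g, 0 < g → Measurable (fun z : ℝ × ℝ => K g z.1 z.2))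
    (hKtrace : ∀ g, 0 < g → ∫ t, K g t t ∂(marginal ρ) = 1)
    {H₁ : ℝ → Type*} [∀ g, NormedAddCommGroup (H₁ g)] [∀ g, InnerProductSpace ℝ (H₁ g)]
    [∀ g, CompleteSpace (H₁ g)] [∀ g, RKHS ℝ (H₁ g) ℝ ℝ]
    (hH₁ : ∀ g, 0 < g → ∀ x t, reproducingKernel (H₁ g) x t = K g x t)
    -- the scale and shape parameters
    (α γ : ℕ → ℝ) (hα : ∀ l, 0 ≤ α l ∧ α l ≤ 1) (hγ : ∀ l, 0 < γ l)
    -- the spaces that the product kernels reproduce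
    {H : ℕ → Type*} [∀ d, NormedAddCommGroup (H d)] [∀ d, InnerProductSpace ℝ (H d)]
    [∀ d, CompleteSpace (H d)] [∀ d, RKHS ℝ (H d) (Fin d → ℝ) ℝ]
    (hH : ∀ d x t, reproducingKernel (H d) x t = productKernel K α γ d x t)
    -- the assumptions
    (hr : 1 / 2 ≤ decayRate α γ)
    (C₁ C₂ C₃ : ℝ) (hC₁ : 0 < C₁) (hC₂ : 0 < C₂) (hC₃ : 0 < C₃)
    (hgtc1 : ∀ g, 0 < g → (∃ l, g ≤ γ l) →
      1 - C₁ * g ^ 2 ≤ ∫ z : ℝ × ℝ, K g z.1 z.2 ∂((marginal ρ).prod (marginal ρ)))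
    (hgtc2 : ∀ g, 0 < g → (∃ l, g ≤ γ l) →
      ENNReal.ofReal C₂ ≤
          tailSum (eigenvalue (H₁ g) (marginal ρ)) g (1 / (2 * decayRate α γ)).toReal ∧
        tailSum (eigenvalue (H₁ g) (marginal ρ)) g (1 / (2 * decayRate α γ)).toReal ≤
          ENNReal.ofReal C₃) :
    -- strong polynomial tractability, with its exponent
    (StronglyPolynomiallyTractable (fun d ε => complexityNorm (H d) (weight ρ d) ε) ∧
      IsTractabilityExponent (fun d ε => complexityNorm (H d) (weight ρ d) ε)
        (1 / decayRate α γ).toReal) ∧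
    -- the rates of the minimal errors
    PreceqPow (fun d n => minimalError (H d) (weight ρ d) n)
      (fun d => embeddingNorm (H d) (weight ρ d)) (-(decayRate α γ : EReal)) ∧
    PreceqPow (fun d n => minimalError (H d) (weight ρ d) n)
      (fun _ => 1) (-(decayRate α γ : EReal)) ∧
    -- the rates of the information complexities
    PreceqEps (fun d ε => complexityNorm (H d) (weight ρ d) ε) (1 / decayRate α γ).toReal ∧
    PreceqEps (fun d ε => complexityAbs (H d) (weight ρ d) ε) (1 / decayRate α γ).toReal := by
  have hprob : IsProbabilityMeasure (marginal ρ) := isProbabilityMeasure_marginal hρ0 hρ1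
  have hr0 : decayRate α γ ≠ 0 := fun h => by simp [h] at hr
  have hx0 : ∀ l, 0 ≤ α l * γ l := fun l => mul_nonneg (hα l).1 (hγ l).le
  have hlim : Filter.Tendsto (fun l => α l * γ l) Filter.atTop (nhds 0) := by
    refine (summable_rpow_of_lt_decayRate hx0 (t := 1 / 4) (by norm_num) ?_).1
    refine lt_of_lt_of_le ?_ hr
    rw [← ENNReal.ofReal_one, ← ENNReal.ofReal_ofNat, ← ENNReal.ofReal_div_of_pos two_pos]
    exact (ENNReal.ofReal_lt_ofReal_iff (by norm_num)).2 (by norm_num)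
  obtain ⟨I, w, S, hw, hwsum, hupper, hlower⟩ := exists_product_weights (G := fun l => H₁ (γ l))
    (fun l => hH₁ _ (hγ l)) (fun l => hKm _ (hγ l)) (fun l => hKtrace _ (hγ l)) hα hγ hH hlim
    hC₁ hC₂ hC₃ (fun l => hgtc1 _ (hγ l) ⟨l, le_rfl⟩) (fun l => hgtc2 _ (hγ l) ⟨l, le_rfl⟩)
  have hw' : ∀ d, IsNormalizedWeight (H d) (weight ρ d) (w d) := hw
  have hpow := preceqPow_of_isNormalizedWeight hw'
    (exists_tsum_rpow_le_of_lt_decayRate hx0 hwsum hupper)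
  have hpow1 : PreceqPow (fun d n => minimalError (H d) (weight ρ d) n) (fun _ => 1)
      (-(decayRate α γ : EReal)) := by
    intro t ht
    obtain ⟨C, hC, h⟩ := hpow t ht
    refine ⟨C, hC, fun d hd n hn => (h d hd n hn).trans ?_⟩
    have := (hw' d).embeddingNorm_le_one
    gcongr
  have hnor : PreceqEps (fun d ε => complexityNorm (H d) (weight ρ d) ε)
      (1 / decayRate α γ).toReal := preceqEps_of_preceqPow hr0 hpow
  have habs : PreceqEps (fun d ε => complexityAbs (H d) (weight ρ d) ε)
      (1 / decayRate α γ).toReal := by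
    have h := preceqEps_of_preceqPow hr0 hpow1
    simp only [mul_one] at h
    exact h
  refine ⟨⟨⟨_, strongBound_of_preceqEps hnor one_pos⟩, fun p hp => ?_, fun p hp => ?_⟩,
    hpow, hpow1, hnor, habs⟩
  · exact le_of_tsum_rpow_le hx0 hr0 hwsum hlower (nonneg_of_strongBound hw' hp)
      fun τ => exists_tsum_rpow_le_of_strongBound hw' hp (τ := τ)
  · exact le_of_forall_pos_le_add fun δ hδ => hp (strongBound_of_preceqEps hnor hδ)
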